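/- Let $m,n,r\in\mathbb N$, $A\in\mathbb R^{m\times n}$, and let $I\subseteq\{1,\dots,m\}\times\{1,\dots,r\}$ and $J\subseteq\{1,\dots,n\}\times\{1,\dots,r\}$ be support constraints. A pair $(X,Y)\in\mathbb R^{m\times r}\times\mathbb R^{n\times r}$ is feasible if $\operatorname{supp}(X)\subseteq I$ and $\operatorname{supp}(Y)\subseteq J$; put $L(X,Y)=\|A-XY^\top\|^2$ (Frobenius norm). A feasible pair is a spurious local minimum if it is a local minimum of $L$ on the set of feasible pairs, but not a global minimum of $L$ on that set. A feasible path is a continuous map from $[0,1]$ to $\mathbb R^{m\times r}\times\mathbb R^{n\times r}$ all of whose values are feasible. For $k\in\{1,\dots,r\}$ let $\mathcal S_k=\{i:(i,k)\in I\}\times\{j:(j,k)\in J\}$. Call $k,l$ equivalent if $\mathcal S_k=\mathcal S_l$. For an equivalence class $P$ let $\mathcal S_P$ be the common value of $\mathcal S_k$, $k\in P$, and let $R_P\subseteq\{1,\dots,m\}$ and $C_P\subseteq\{1,\dots,n\}$ be the sets of rows and columns met by $\mathcal S_P$. The class $P$ is complete (a CEC) if $|P|\ge\min\{|C_P|,|R_P|\}$.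 Let $T$ be the union of all CECs, let $\mathcal S_T$ be the union of the sets $\mathcal S_P$ over all CECs $P$, and for $k\notin T$ let $\mathcal S'_k=\mathcal S_k\setminus\mathcal S_T$. A feasible pair $(X,Y)$ is CEC-full-rank if for every CEC $P$ at least one of the submatrices $X_{R_P,P}$ and $Y_{C_P,P}$ has full row rank. Theorem. Assume that for every $k\notin T$ the set $\mathcal S'_k$ is rectangular, that is, of the form $R\times C$ with $R\subseteq\{1,\dots,m\}$ and $C\subseteq\{1,\dots,n\}$, and that for all $k,l\notin T$ either $\mathcal S'_k=\mathcal S'_l$ or $\mathcal S'_k\cap\mathcal S'_l=\emptyset$. Let $(X,Y)$ be a feasible pair. If $(X,Y)$ is CEC-full-rank, then $(X,Y)$ is not a spurious local minimum. Otherwise there is a feasible path along which $L$ is constant and which joins $(X,Y)$ to some $(\tilde X,\tilde Y)$ that is not a spurious local minimum. -/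

import Mathlib

namespace FixedSupport

variable {m n r : ℕ}

/-- Support of the `k`-th rank-one contribution: `supp(I_{•,k}) × supp(J_{•,k})`. A support
constraint is a set of (row, column) positions. -/
def rankOneSupport (I : Finset (Fin m × Fin r)) (J : Finset (Fin n × Fin r)) (k : Fin r) :
    Finset (Fin m × Fin n) :=
  (Finset.univ.filter fun i => (i, k) ∈ I) ×ˢ (Finset.univ.filter fun j => (j, k) ∈ J)

/-- The collection of equivalence classes of indices: two indices are equivalent when they have
the same rank-one support. -/
def classes (I : Finset (Fin m × Fin r)) (J : Finset (Fin n × Fin r)) : Finset (Finset (Fin r)) :=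
  Finset.univ.image fun k => Finset.univ.filter fun l => rankOneSupport I J l = rankOneSupport I J k

/-- The rank-one support shared by all the indices of a class `P`, written as their union. -/
def classSupport (I : Finset (Fin m × Fin r)) (J : Finset (Fin n × Fin r)) (P : Finset (Fin r)) :
    Finset (Fin m × Fin n) :=
  P.biUnion (rankOneSupport I J)

/-- `R_P`: the rows met by the support of the class `P`. -/
def classRows (I : Finset (Fin m × Fin r)) (J : Finset (Fin n × Fin r)) (P : Finset (Fin r)) :
    Finset (Fin m) :=
  (classSupport I J P).image Prod.fst

/-- `C_P`: the columns met by the support of the class `P`. -/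
def classCols (I : Finset (Fin m × Fin r)) (J : Finset (Fin n × Fin r)) (P : Finset (Fin r)) :
    Finset (Fin n) :=
  (classSupport I J P).image Prod.snd

/-- The complete equivalence classes (CECs). -/
def completeClasses (I : Finset (Fin m × Fin r)) (J : Finset (Fin n × Fin r)) :
    Finset (Finset (Fin r)) :=
  (classes I J).filter fun P => min (classCols I J P).card (classRows I J P).card ≤ P.card

/-- `T`: the indices that belong to some complete equivalence class. -/
def completeIndices (I : Finset (Fin m × Fin r)) (J : Finset (Fin n × Fin r)) : Finset (Fin r) :=
  (completeClasses I J).biUnion id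

/-- `S_T`: the union of the supports of the complete equivalence classes. -/
def completeSupport (I : Finset (Fin m × Fin r)) (J : Finset (Fin n × Fin r)) :
    Finset (Fin m × Fin n) :=
  (completeClasses I J).biUnion (classSupport I J)

/-- `S'_k`: the part of the `k`-th rank-one support outside the CECs. -/
def outsideSupport (I : Finset (Fin m × Fin r)) (J : Finset (Fin n × Fin r)) (k : Fin r) :
    Finset (Fin m × Fin n) :=
  rankOneSupport I J k \ completeSupport I J

/-- A set of matrix positions is rectangular if it is a product of a set of rows and a set of
columns. -/
def IsRectangular (S : Finset (Fin m × Fin n)) : Prop :=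
  ∃ (R : Finset (Fin m)) (C : Finset (Fin n)), S = R ×ˢ C

/-- The feasible pairs `(X, Y)`: `supp(X) ⊆ I` and `supp(Y) ⊆ J`. -/
def feasible (I : Finset (Fin m × Fin r)) (J : Finset (Fin n × Fin r)) :
    Set (Matrix (Fin m) (Fin r) ℝ × Matrix (Fin n) (Fin r) ℝ) :=
  {p | (∀ i k, p.1 i k ≠ 0 → (i, k) ∈ I) ∧ (∀ j k, p.2 j k ≠ 0 → (j, k) ∈ J)}

/-- The loss `‖A - X Yᵀ‖²` (squared Frobenius norm). -/
def loss (A : Matrix (Fin m) (Fin n) ℝ)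
    (p : Matrix (Fin m) (Fin r) ℝ × Matrix (Fin n) (Fin r) ℝ) : ℝ :=
  ∑ i, ∑ j, ((A - p.1 * p.2.transpose) i j) ^ 2

/-- `(X, Y)` is a spurious local minimum of the loss over the feasible set: a local minimum that
is not a global minimum. -/
def IsSpuriousLocalMin (A : Matrix (Fin m) (Fin n) ℝ) (I : Finset (Fin m × Fin r))
    (J : Finset (Fin n × Fin r))
    (p : Matrix (Fin m) (Fin r) ℝ × Matrix (Fin n) (Fin r) ℝ) : Prop :=
  p ∈ feasible I J ∧ IsLocalMinOn (loss A) (feasible I J) p ∧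
    ¬ IsMinOn (loss A) (feasible I J) p

/-- The submatrix `M_{R,P}` has full row rank. -/
def SubFullRowRank {d : ℕ} (M : Matrix (Fin d) (Fin r) ℝ) (R : Finset (Fin d))
    (P : Finset (Fin r)) : Prop :=
  (M.submatrix (fun i : R => (i : Fin d)) (fun k : P => (k : Fin r))).rank = R.card

/-- For every complete class `P`, `X_{R_P,P}` or `Y_{C_P,P}` has full row rank. -/
def CECFullRank (I : Finset (Fin m × Fin r)) (J : Finset (Fin n × Fin r))
    (p : Matrix (Fin m) (Fin r) ℝ × Matrix (Fin n) (Fin r) ℝ) : Prop :=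
  ∀ P ∈ completeClasses I J,
    SubFullRowRank p.1 (classRows I J P) P ∨ SubFullRowRank p.2 (classCols I J P) P

end FixedSupport

/-! The product `X Yᵀ` is a sum over columns, so perturbations of disjoint sets of columns act on it
independently. If `X_{R_P,P}` has a right inverse, any change of the product on `R_P × C_P` is
obtained by moving only the `P`-columns of `Y`, linearly in that change; symmetrically for
`Y_{C_P,P}`. Collected over all complete classes, this gives a continuous correction on `S_T` that
uses only columns in `T` (`CECFullRank.hasCorrection`).

Hence at a CEC-full-rank local minimum the residual vanishes on `S_T`: otherwise the product could
be moved towards `A` there. Outside `S_T`, the distinct nonempty sets `S'_k` are disjoint rectangles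
`R × C`. On such a rectangle only the columns `Q` with `S'_k = R × C` contribute, and they are
unconstrained on `R` and `C`. Varying them may disturb the product on `S_T`, but the correction
undoes this. So the restriction to the rectangle is a local minimum of an unconstrained
factorization problem, and these have no spurious local minima (`IsLocalMin.frobSq_le`). Positions
in neither `S_T` nor a rectangle have product zero for every feasible pair. The loss is thus minimal
on each piece (`CECFullRank.isMinOn`).

The unconstrained statement follows from the second-order conditions. A kernel vector of `X` forces
the residual `R` to vanish. Otherwise a change of basis makes the columns of `X` orthonormal and
those of `Y` orthogonal, and rank-one directions show that `R` is dominated by every squared column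
norm of `Y`, which makes `X Yᵀ` a best approximation.

For the path, suppose a class has at least as many columns as `X_{R_P,P}` has rows. First project
the rows of `Y_{C_P,P}` so that the directions killed by `X_{R_P,P}` become unused, then fill these
directions of `X_{R_P,P}` to reach full row rank. Neither move changes the product, hence the loss
(`exists_joinedIn_cecFullRank`). -/

open Matrix Filter Topology

namespace FixedSupport

/-! ### Unconstrained factorization: optimality conditions and best approximation. -/

section LowRank

variable {α β κ : Type*} [Fintype α] [Fintype β] [Fintype κ]

/-- The Frobenius inner product of two real matrices. -/
def frobInner (M N : Matrix α β ℝ) : ℝ := (Mᵀ * N).trace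

/-- The squared Frobenius norm of a real matrix. -/
def frobSq (M : Matrix α β ℝ) : ℝ := ∑ i, ∑ j, M i j ^ 2

theorem frobInner_eq_sum (M N : Matrix α β ℝ) : frobInner M N = ∑ i, ∑ j, M i j * N i j := by
  simp only [frobInner, Matrix.trace, Matrix.diag, Matrix.mul_apply, Matrix.transpose_apply]
  exact Finset.sum_comm

theorem frobInner_self (M : Matrix α β ℝ) : frobInner M M = frobSq M := by
  simp only [frobInner_eq_sum, frobSq, sq]

theorem frobInner_comm (M N : Matrix α β ℝ) : frobInner M N = frobInner N M := by
  simp only [frobInner_eq_sum, mul_comm]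

theorem frobSq_nonneg (M : Matrix α β ℝ) : 0 ≤ frobSq M :=
  Finset.sum_nonneg fun _ _ => Finset.sum_nonneg fun _ _ => sq_nonneg _

theorem frobSq_eq_zero {M : Matrix α β ℝ} : frobSq M = 0 ↔ M = 0 := by
  constructor
  · intro h
    ext i j
    have h1 := (Finset.sum_eq_zero_iff_of_nonneg
      (fun i _ => Finset.sum_nonneg fun j _ => sq_nonneg (M i j))).1 h i (Finset.mem_univ i)
    have h2 := (Finset.sum_eq_zero_iff_of_nonneg
      (fun j _ => sq_nonneg (M i j))).1 h1 j (Finset.mem_univ j)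
    simpa using h2
  · rintro rfl
    simp [frobSq]

theorem frobSq_sub (M N : Matrix α β ℝ) :
    frobSq (M - N) = frobSq M - 2 * frobInner M N + frobSq N := by
  simp only [frobSq, frobInner_eq_sum, Finset.mul_sum, ← Finset.sum_sub_distrib,
    ← Finset.sum_add_distrib, Matrix.sub_apply]
  exact Finset.sum_congr rfl fun i _ => Finset.sum_congr rfl fun j _ => by ring

theorem frobSq_add (M N : Matrix α β ℝ) :
    frobSq (M + N) = frobSq M + 2 * frobInner M N + frobSq N := by
  simp only [frobSq, frobInner_eq_sum, Finset.mul_sum,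
    ← Finset.sum_add_distrib, Matrix.add_apply]
  exact Finset.sum_congr rfl fun i _ => Finset.sum_congr rfl fun j _ => by ring

theorem frobSq_transpose (M : Matrix α β ℝ) : frobSq Mᵀ = frobSq M := by
  simp only [frobSq, Matrix.transpose_apply]
  exact Finset.sum_comm

theorem frobInner_mul_right (M : Matrix α β ℝ) (U : Matrix α κ ℝ) (V : Matrix κ β ℝ) :
    frobInner M (U * V) = frobInner (Uᵀ * M) V := by
  simp [frobInner, Matrix.mul_assoc]

theorem frobInner_mul_transpose_right (M : Matrix α β ℝ) (U : Matrix α κ ℝ) (V : Matrix β κ ℝ) :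
    frobInner M (U * Vᵀ) = frobInner (M * V) U := by
  simp only [frobInner, Matrix.transpose_mul]
  rw [← Matrix.mul_assoc, Matrix.trace_mul_comm, Matrix.mul_assoc]

/-- Second-order expansion of the squared Frobenius norm along a quadratic curve. -/
theorem frobSq_sub_quadratic (R E F : Matrix α β ℝ) (t : ℝ) :
    frobSq (R - (t • E + t ^ 2 • F)) = frobSq R + t * (-2 * frobInner R E)
      + t ^ 2 * (frobSq E - 2 * frobInner R F + t * (2 * frobInner E F + t * frobSq F)) := by
  simp only [frobSq, frobInner_eq_sum, Finset.mul_sum, ← Finset.sum_sub_distrib,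
    ← Finset.sum_add_distrib, Matrix.add_apply, Matrix.sub_apply, Matrix.smul_apply, smul_eq_mul]
  exact Finset.sum_congr rfl fun i _ => Finset.sum_congr rfl fun j _ => by ring

theorem nonneg_of_eventually_nonneg_mul {l : Filter ℝ} [l.NeBot] (hl : l ≤ 𝓝 0) {g s : ℝ → ℝ}
    (hg : Continuous g) (hs : ∀ᶠ t in l, 0 < s t) (h : ∀ᶠ t in l, 0 ≤ s t * g t) : 0 ≤ g 0 := by
  refine ge_of_tendsto ((hg.tendsto 0).mono_left hl) ?_
  filter_upwards [hs, h] with t h1 h2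
  exact nonneg_of_mul_nonneg_right h2 h1

/-- Dividing by `t` from the right and from the left gives both signs of `a`; with `a = 0`, dividing
by `t ^ 2` gives the sign of `b`. -/
theorem quadratic_conditions {a b c d : ℝ}
    (h : ∀ᶠ t in 𝓝 (0 : ℝ), 0 ≤ t * a + t ^ 2 * (b + t * (c + t * d))) : a = 0 ∧ 0 ≤ b := by
  have h1 : 0 ≤ a := by
    have := nonneg_of_eventually_nonneg_mul (l := 𝓝[>] (0 : ℝ)) nhdsWithin_le_nhds
      (g := fun t => a + t * (b + t * (c + t * d))) (s := fun t => t) (by fun_prop)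
      self_mem_nhdsWithin (by
        filter_upwards [nhdsWithin_le_nhds h] with t ht
        linarith [show t * a + t ^ 2 * (b + t * (c + t * d))
          = t * (a + t * (b + t * (c + t * d))) by ring])
    simpa using this
  have h2 : 0 ≤ -a := by
    have := nonneg_of_eventually_nonneg_mul (l := 𝓝[<] (0 : ℝ)) nhdsWithin_le_nhds
      (g := fun t => -(a + t * (b + t * (c + t * d)))) (s := fun t => -t) (by fun_prop)
      (by filter_upwards [self_mem_nhdsWithin] with t ht using neg_pos.2 ht) (by
        filter_upwards [nhdsWithin_le_nhds h] with t ht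
        linarith [show t * a + t ^ 2 * (b + t * (c + t * d))
          = -t * -(a + t * (b + t * (c + t * d))) by ring])
    simpa using this
  have ha : a = 0 := by linarith
  refine ⟨ha, ?_⟩
  have := nonneg_of_eventually_nonneg_mul (l := 𝓝[>] (0 : ℝ)) nhdsWithin_le_nhds
    (g := fun t => b + t * (c + t * d)) (s := fun t => t ^ 2) (by fun_prop)
    (by filter_upwards [self_mem_nhdsWithin] with t ht using pow_pos ht 2) (by
      filter_upwards [nhdsWithin_le_nhds h] with t ht
      rw [ha] at ht
      linarith)
  simpa using this

variable {A : Matrix α β ℝ} {X : Matrix α κ ℝ} {Y : Matrix β κ ℝ}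

/-- First and second order necessary conditions at a local minimum of `‖A - X Yᵀ‖²`. -/
theorem IsLocalMin.frobSq_conditions
    (h : IsLocalMin (fun p : Matrix α κ ℝ × Matrix β κ ℝ => frobSq (A - p.1 * p.2ᵀ)) (X, Y))
    (U : Matrix α κ ℝ) (V : Matrix β κ ℝ) :
    frobInner (A - X * Yᵀ) (U * Yᵀ + X * Vᵀ) = 0 ∧
      2 * frobInner (A - X * Yᵀ) (U * Vᵀ) ≤ frobSq (U * Yᵀ + X * Vᵀ) := by
  have hc : Tendsto (fun t : ℝ => (X + t • U, Y + t • V)) (𝓝 0) (𝓝 (X, Y)) := by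
    have : Continuous (fun t : ℝ => (X + t • U, Y + t • V)) := by fun_prop
    simpa using this.tendsto 0
  have h1 := hc.eventually h
  have h2 : ∀ᶠ t in 𝓝 (0 : ℝ), 0 ≤ t * (-2 * frobInner (A - X * Yᵀ) (U * Yᵀ + X * Vᵀ))
      + t ^ 2 * ((frobSq (U * Yᵀ + X * Vᵀ) - 2 * frobInner (A - X * Yᵀ) (U * Vᵀ))
        + t * (2 * frobInner (U * Yᵀ + X * Vᵀ) (U * Vᵀ) + t * frobSq (U * Vᵀ))) := by
    filter_upwards [h1] with t ht
    have e : A - (X + t • U) * (Y + t • V)ᵀ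
        = (A - X * Yᵀ) - (t • (U * Yᵀ + X * Vᵀ) + t ^ 2 • (U * Vᵀ)) := by
      simp only [Matrix.transpose_add, Matrix.transpose_smul, Matrix.add_mul, Matrix.mul_add,
        Matrix.smul_mul, Matrix.mul_smul, smul_add, smul_smul, sq]
      abel
    simp only [e, frobSq_sub_quadratic] at ht
    linarith
  obtain ⟨h3, h4⟩ := quadratic_conditions h2
  exact ⟨by linarith, by linarith⟩

/-- In the direction `U = (A - X Yᵀ) Y`, `V = 0`, the first-order term is the squared norm of `(A -
X Yᵀ) Y`. -/
theorem IsLocalMin.residual_mul_eq_zero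
    (h : IsLocalMin (fun p : Matrix α κ ℝ × Matrix β κ ℝ => frobSq (A - p.1 * p.2ᵀ)) (X, Y)) :
    (A - X * Yᵀ) * Y = 0 := by
  have := (IsLocalMin.frobSq_conditions h ((A - X * Yᵀ) * Y) 0).1
  rw [Matrix.transpose_zero, Matrix.mul_zero, add_zero, frobInner_mul_transpose_right,
    frobInner_self] at this
  exact frobSq_eq_zero.1 this

theorem IsLocalMin.residual_transpose_mul_eq_zero
    (h : IsLocalMin (fun p : Matrix α κ ℝ × Matrix β κ ℝ => frobSq (A - p.1 * p.2ᵀ)) (X, Y)) :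
    (A - X * Yᵀ)ᵀ * X = 0 := by
  have := (IsLocalMin.frobSq_conditions h 0 ((A - X * Yᵀ)ᵀ * X)).1
  rw [Matrix.zero_mul, zero_add, frobInner_mul_right, Matrix.transpose_mul,
    Matrix.transpose_transpose, frobInner_self] at this
  rw [← Matrix.transpose_inj, Matrix.transpose_mul, Matrix.transpose_transpose,
    frobSq_eq_zero.1 this, Matrix.transpose_zero]

theorem frobInner_vecMulVec (M : Matrix α β ℝ) (u : α → ℝ) (v : β → ℝ) :
    frobInner M (vecMulVec u v) = u ⬝ᵥ (M *ᵥ v) := by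
  simp only [frobInner_eq_sum, vecMulVec_apply, dotProduct, mulVec, Finset.mul_sum]
  exact Finset.sum_congr rfl fun i _ => Finset.sum_congr rfl fun j _ => by ring

theorem frobSq_vecMulVec (u : α → ℝ) (v : β → ℝ) :
    frobSq (vecMulVec u v) = (u ⬝ᵥ u) * (v ⬝ᵥ v) := by
  simp only [frobSq, vecMulVec_apply, dotProduct, Finset.sum_mul_sum]
  exact Finset.sum_congr rfl fun i _ => Finset.sum_congr rfl fun j _ => by ring

/-- The second-order condition in rank-one directions. -/
theorem IsLocalMin.rank_one_condition
    (h : IsLocalMin (fun p : Matrix α κ ℝ × Matrix β κ ℝ => frobSq (A - p.1 * p.2ᵀ)) (X, Y))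
    (u : α → ℝ) (p : β → ℝ) (a w : κ → ℝ) :
    2 * ((a ⬝ᵥ w) * (u ⬝ᵥ ((A - X * Yᵀ) *ᵥ p))) ≤
      (u ⬝ᵥ u) * ((Y *ᵥ a) ⬝ᵥ (Y *ᵥ a)) + ((X *ᵥ w) ⬝ᵥ (X *ᵥ w)) * (p ⬝ᵥ p)
        + 2 * ((u ⬝ᵥ (X *ᵥ w)) * ((Y *ᵥ a) ⬝ᵥ p)) := by
  have h2 := (IsLocalMin.frobSq_conditions h (vecMulVec u a) (vecMulVec p w)).2
  have e1 : vecMulVec u a * (vecMulVec p w)ᵀ = (a ⬝ᵥ w) • vecMulVec u p := by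
    rw [transpose_vecMulVec, vecMulVec_mul_vecMulVec]
    ext i j
    simp [vecMulVec_apply]
    ring
  have e2 : vecMulVec u a * Yᵀ = vecMulVec u (Y *ᵥ a) := by
    rw [vecMulVec_mul, vecMul_transpose]
  have e3 : X * (vecMulVec p w)ᵀ = vecMulVec (X *ᵥ w) p := by
    rw [transpose_vecMulVec, mul_vecMulVec]
  rw [e1, e2, e3, frobSq_add, frobSq_vecMulVec, frobSq_vecMulVec, frobInner_vecMulVec] at h2
  have e4 : frobInner (A - X * Yᵀ) ((a ⬝ᵥ w) • vecMulVec u p)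
      = (a ⬝ᵥ w) * (u ⬝ᵥ ((A - X * Yᵀ) *ᵥ p)) := by
    rw [← frobInner_vecMulVec]
    simp [frobInner]
  have e5 : (X *ᵥ w) ⬝ᵥ (vecMulVec u (Y *ᵥ a) *ᵥ p) = (u ⬝ᵥ (X *ᵥ w)) * ((Y *ᵥ a) ⬝ᵥ p) := by
    rw [vecMulVec_mulVec, op_smul_eq_smul, dotProduct_smul, smul_eq_mul,
      dotProduct_comm u, mul_comm]
  rw [e4, e5] at h2
  linarith

/-- With `a = w = v` every term containing `X w` drops out of the rank-one condition. Scaling `p` by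
`s` then leaves a linear function of `s` bounded above, so its slope is zero. -/
theorem IsLocalMin.residual_eq_zero_of_mulVec_eq_zero
    (h : IsLocalMin (fun p : Matrix α κ ℝ × Matrix β κ ℝ => frobSq (A - p.1 * p.2ᵀ)) (X, Y))
    {v : κ → ℝ} (hv : v ≠ 0) (hX : X *ᵥ v = 0) : A - X * Yᵀ = 0 := by
  classical
  have key : ∀ (u : α → ℝ) (p : β → ℝ), u ⬝ᵥ ((A - X * Yᵀ) *ᵥ p) = 0 := by
    intro u p
    set z := u ⬝ᵥ ((A - X * Yᵀ) *ᵥ p) with hz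
    have hvv : 0 < v ⬝ᵥ v := by
      have h0 : 0 ≤ v ⬝ᵥ v := Finset.sum_nonneg fun i _ => mul_self_nonneg _
      exact lt_of_le_of_ne h0 fun h => hv (dotProduct_self_eq_zero.1 h.symm)
    have hs : ∀ s : ℝ, 2 * (s * ((v ⬝ᵥ v) * z)) ≤ (u ⬝ᵥ u) * ((Y *ᵥ v) ⬝ᵥ (Y *ᵥ v)) := by
      intro s
      have := IsLocalMin.rank_one_condition h u (s • p) v v
      rw [hX] at this
      simp only [mulVec_smul, dotProduct_smul, smul_eq_mul, dotProduct_zero,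
        ← hz] at this
      linarith
    by_contra hne
    have hne' : (v ⬝ᵥ v) * z ≠ 0 := mul_ne_zero hvv.ne' hne
    -- This `s` makes the left side twice the bound plus two.
    have := hs ((((u ⬝ᵥ u) * ((Y *ᵥ v) ⬝ᵥ (Y *ᵥ v))) + 1) / ((v ⬝ᵥ v) * z))
    rw [div_mul_cancel₀ _ hne'] at this
    have h0 : 0 ≤ (u ⬝ᵥ u) * ((Y *ᵥ v) ⬝ᵥ (Y *ᵥ v)) :=
      mul_nonneg (Finset.sum_nonneg fun i _ => mul_self_nonneg _)
        (Finset.sum_nonneg fun i _ => mul_self_nonneg _)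
    linarith
  ext i j
  simpa using key (Pi.single i 1) (Pi.single j 1)

open scoped MatrixOrder Matrix.Norms.L2Operator in
/-- If the columns of `X` are independent, then `X Yᵀ` has a factorization with orthonormal left
factor and orthogonal right factor, obtained by a change of basis. -/
theorem exists_orthogonal_factors [DecidableEq κ] (X : Matrix α κ ℝ) (Y : Matrix β κ ℝ)
    (hX : Function.Injective X.mulVec) :
    ∃ (W Z : Matrix κ κ ℝ) (μ : κ → ℝ), Zᵀ * W = 1 ∧ W * Zᵀ = 1 ∧
      (X * W)ᵀ * (X * W) = 1 ∧ (Y * Z)ᵀ * (Y * Z) = diagonal μ := by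
  have hG : (Xᵀ * X).PosDef := by
    have := Matrix.PosDef.conjTranspose_mul_self X hX
    simpa using this
  -- Since `Bᵀ B = Xᵀ X`, the columns of `X B⁻¹` are orthonormal. An orthogonal `O` preserves this
  -- and is free to diagonalize the Gram matrix of `Y Bᵀ`.
  obtain ⟨B, hB⟩ := CStarAlgebra.nonneg_iff_eq_star_mul_self.mp hG.posSemidef.nonneg
  rw [star_eq_conjTranspose, conjTranspose_eq_transpose_of_trivial] at hB
  have hBu : IsUnit B.det := by
    have h1 := hG.det_pos
    rw [hB, det_mul, det_transpose] at h1
    exact isUnit_iff_ne_zero.2 fun h0 => by simp [h0] at h1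
  have hH : (B * (Yᵀ * Y) * Bᵀ).IsHermitian := by
    simp [Matrix.IsHermitian, Matrix.mul_assoc]
  set O : Matrix κ κ ℝ := (hH.eigenvectorUnitary : Matrix κ κ ℝ) with hO
  have hO1 : Oᵀ * O = 1 := by
    have := (Matrix.mem_unitaryGroup_iff').1 hH.eigenvectorUnitary.2
    simpa [star_eq_conjTranspose] using this
  have hspec : Oᵀ * (B * (Yᵀ * Y) * Bᵀ) * O = diagonal hH.eigenvalues := by
    have h := hH.spectral_theorem
    rw [Unitary.conjStarAlgAut_apply] at h
    simp only [star_eq_conjTranspose, conjTranspose_eq_transpose_of_trivial, ← hO] at h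
    refine (congrArg (fun N => Oᵀ * N * O) h).trans ?_
    have : Oᵀ * (O * diagonal (RCLike.ofReal ∘ hH.eigenvalues) * Oᵀ) * O
        = (Oᵀ * O) * diagonal (RCLike.ofReal ∘ hH.eigenvalues) * (Oᵀ * O) := by
      simp only [Matrix.mul_assoc]
    simp only [this, hO1, Matrix.one_mul, Matrix.mul_one]
    rfl
  have hBB : B * B⁻¹ = 1 := mul_nonsing_inv B hBu
  have hBB' : B⁻¹ * B = 1 := nonsing_inv_mul B hBu
  have hZW : (Bᵀ * O)ᵀ * (B⁻¹ * O) = 1 := by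
    rw [transpose_mul, transpose_transpose, Matrix.mul_assoc, ← Matrix.mul_assoc B, hBB,
      Matrix.one_mul, hO1]
  refine ⟨B⁻¹ * O, Bᵀ * O, hH.eigenvalues, hZW, mul_eq_one_comm.1 hZW, ?_, ?_⟩
  · have : (X * (B⁻¹ * O))ᵀ * (X * (B⁻¹ * O)) = Oᵀ * ((B * B⁻¹)ᵀ * (B * B⁻¹)) * O := by
      calc _ = Oᵀ * ((B⁻¹)ᵀ * (Xᵀ * X) * B⁻¹) * O := by
            simp only [transpose_mul, Matrix.mul_assoc]
        _ = _ := by rw [hB]; simp only [transpose_mul, Matrix.mul_assoc]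
    rw [this, hBB]
    simpa using hO1
  · rw [← hspec]
    simp only [transpose_mul, transpose_transpose, Matrix.mul_assoc]

/-- Every matrix factors through an orthonormal family of at most as many columns. -/
theorem exists_orthonormal_columns (U : Matrix α κ ℝ) :
    ∃ (d : ℕ) (Q : Matrix α (Fin d) ℝ) (K : Matrix (Fin d) κ ℝ),
      d ≤ Fintype.card κ ∧ Qᵀ * Q = 1 ∧ U = Q * K := by
  classical
  let c : κ → EuclideanSpace ℝ α := fun k => WithLp.toLp 2 (fun i => U i k)
  let S := Submodule.span ℝ (Set.range c)
  let b := stdOrthonormalBasis ℝ S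
  refine ⟨Module.finrank ℝ S, Matrix.of fun i l => (b l : EuclideanSpace ℝ α) i,
    Matrix.of fun l k => b.repr ⟨c k, Submodule.subset_span ⟨k, rfl⟩⟩ l,
    finrank_range_le_card c, ?_, ?_⟩
  · ext l l'
    have h := orthonormal_iff_ite.1 b.orthonormal l l'
    rw [Submodule.coe_inner] at h
    rw [Matrix.one_apply, ← h]
    rw [Matrix.mul_apply, PiLp.inner_apply]
    exact Finset.sum_congr rfl fun i _ => mul_comm _ _
  · ext i k
    have h := b.sum_repr ⟨c k, Submodule.subset_span ⟨k, rfl⟩⟩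
    have h' := congrArg (fun x : S => (x : EuclideanSpace ℝ α) i) h
    simp only [Submodule.coe_sum, Submodule.coe_smul, WithLp.ofLp_sum, Finset.sum_apply,
      PiLp.smul_apply, smul_eq_mul] at h'
    rw [Matrix.mul_apply, show U i k = (c k) i from rfl, ← h']
    exact Finset.sum_congr rfl fun l _ => mul_comm _ _

/-- A decomposition `A = X Yᵀ + R` whose first part dominates the second one is a best
approximation of rank at most the number of columns of `X`. -/
theorem frobSq_residual_le_of_dominated [DecidableEq κ] (A R : Matrix α β ℝ) (X : Matrix α κ ℝ)
    (Y : Matrix β κ ℝ) (μ : κ → ℝ) (hA : A = X * Yᵀ + R) (hX : Xᵀ * X = 1)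
    (hY : Yᵀ * Y = diagonal μ) (hRY : R * Y = 0) (hRX : Rᵀ * X = 0)
    (hdom : ∀ (u : α → ℝ) (k : κ), (u ᵥ* R) ⬝ᵥ (u ᵥ* R) ≤ μ k * (u ⬝ᵥ u))
    (U : Matrix α κ ℝ) (V : Matrix β κ ℝ) : frobSq R ≤ frobSq (A - U * Vᵀ) := by
  have hXR : Xᵀ * R = 0 := by
    rw [← transpose_inj, transpose_mul, transpose_transpose, hRX, transpose_zero]
  have hYR : Yᵀ * Rᵀ = 0 := by
    rw [← transpose_mul, hRY, transpose_zero]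
  have hμ : ∀ k, 0 ≤ μ k := fun k => by
    have := congrFun (congrFun hY k) k
    rw [diagonal_apply_eq, Matrix.mul_apply] at this
    rw [← this]
    exact Finset.sum_nonneg fun i _ => mul_self_nonneg _
  have hnA : frobSq A = ∑ k, μ k + frobSq R := by
    have h1 : frobInner (X * Yᵀ) R = 0 := by
      rw [frobInner_comm, frobInner_mul_right, hXR]; simp [frobInner]
    have h2 : frobSq (X * Yᵀ) = ∑ k, μ k := by
      rw [← frobInner_self, frobInner_mul_right, ← Matrix.mul_assoc, hX, Matrix.one_mul,
        frobInner, transpose_transpose, trace_mul_comm, hY, trace_diagonal]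
    rw [hA, frobSq_add, h1, h2]; ring
  obtain ⟨d, Q, K, hd, hQ, hU⟩ := exists_orthonormal_columns U
  set C : Matrix κ (Fin d) ℝ := Xᵀ * Q with hC
  have hQX : Qᵀ * X = Cᵀ := by rw [hC, transpose_mul, transpose_transpose]
  -- the optimal right factor for the orthonormal left factor `Q` is `Aᵀ Q`
  have hlow : frobSq A - frobSq (Aᵀ * Q) ≤ frobSq (A - U * Vᵀ) := by
    have e : U * Vᵀ = Q * (V * Kᵀ)ᵀ := by
      rw [hU, transpose_mul, transpose_transpose, Matrix.mul_assoc]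
    have e2 : frobSq (Q * (V * Kᵀ)ᵀ) = frobSq (V * Kᵀ) := by
      rw [← frobInner_self, frobInner_mul_right, ← Matrix.mul_assoc, hQ, Matrix.one_mul,
        frobInner_self, frobSq_transpose]
    have e3 : frobInner A (Q * (V * Kᵀ)ᵀ) = frobInner (Aᵀ * Q) (V * Kᵀ) := by
      rw [frobInner_mul_right]
      simp only [frobInner, transpose_mul, transpose_transpose]
      rw [← trace_transpose]
      simp only [transpose_mul, transpose_transpose, Matrix.mul_assoc]
      rw [trace_mul_comm, Matrix.mul_assoc, trace_mul_comm Kᵀ]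
      simp only [Matrix.mul_assoc]
    rw [e, frobSq_sub, e2, e3]
    have := frobSq_nonneg (Aᵀ * Q - V * Kᵀ)
    rw [frobSq_sub] at this
    linarith
  set s : κ → ℝ := fun k => ∑ l, C k l ^ 2 with hs
  have hsC : frobSq C = ∑ k, s k := rfl
  -- `1 - C Cᵀ` is the Gram matrix of `X - Q Cᵀ`, so its diagonal is nonnegative.
  have hs1 : ∀ k, s k ≤ 1 := by
    intro k
    have e : (X - Q * Cᵀ)ᵀ * (X - Q * Cᵀ) = 1 - C * Cᵀ := by
      simp only [transpose_sub, transpose_mul, transpose_transpose, Matrix.sub_mul,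
        Matrix.mul_sub, hX]
      have e1 : Xᵀ * (Q * Cᵀ) = C * Cᵀ := by rw [← Matrix.mul_assoc]
      have e2 : C * Qᵀ * X = C * Cᵀ := by rw [Matrix.mul_assoc, hQX]
      have e3 : C * Qᵀ * (Q * Cᵀ) = C * Cᵀ := by
        rw [Matrix.mul_assoc, ← Matrix.mul_assoc Qᵀ, hQ, Matrix.one_mul]
      rw [e1, e2, e3]
      abel
    have h := congrFun (congrFun e k) k
    rw [Matrix.mul_apply, Matrix.sub_apply, Matrix.one_apply_eq, Matrix.mul_apply] at h
    have h0 : 0 ≤ ∑ j, (X - Q * Cᵀ)ᵀ k j * (X - Q * Cᵀ) j k :=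
      Finset.sum_nonneg fun i _ => mul_self_nonneg _
    have h1 : s k = ∑ j, C k j * Cᵀ j k := Finset.sum_congr rfl fun j _ => by
      rw [transpose_apply, sq]
    linarith
  have hsplit : frobSq (Aᵀ * Q) = ∑ k, μ k * s k + frobSq (Rᵀ * Q) := by
    have e : Aᵀ * Q = Y * C + Rᵀ * Q := by
      rw [hA, transpose_add, transpose_mul, transpose_transpose, Matrix.add_mul,
        Matrix.mul_assoc]
    have e1 : frobInner (Y * C) (Rᵀ * Q) = 0 := by
      rw [frobInner_comm, frobInner_mul_right, ← Matrix.mul_assoc, hYR, Matrix.zero_mul]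
      simp [frobInner]
    have e2 : frobSq (Y * C) = ∑ k, μ k * s k := by
      rw [← frobInner_self, frobInner_mul_right, ← Matrix.mul_assoc, hY, frobInner_eq_sum]
      refine Finset.sum_congr rfl fun k _ => ?_
      rw [hs, Finset.mul_sum]
      refine Finset.sum_congr rfl fun l _ => ?_
      rw [diagonal_mul]
      ring
    rw [e, frobSq_add, e1, e2]; ring
  suffices hmain : frobSq (Aᵀ * Q) ≤ ∑ k, μ k by linarith
  have hdist : frobSq (Q - X * C) = d - ∑ k, s k := by
    have e1 : frobInner Q (X * C) = frobSq C := by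
      rw [frobInner_mul_right, frobInner_self]
    have e2 : frobSq (X * C) = frobSq C := by
      rw [← frobInner_self, frobInner_mul_right, ← Matrix.mul_assoc, hX, Matrix.one_mul,
        frobInner_self]
    have e3 : frobSq Q = d := by
      rw [← frobInner_self, frobInner, hQ, trace_one, Fintype.card_fin]
    rw [frobSq_sub, e1, e2, e3, hsC]; ring
  -- Since `Rᵀ X = 0`, only the part of `Q` orthogonal to the columns of `X` meets `R`; domination
  -- is applied to each of its columns.
  have hR : ∀ k, frobSq (Rᵀ * Q) ≤ μ k * (d - ∑ k, s k) := by
    intro k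
    have e : Rᵀ * Q = Rᵀ * (Q - X * C) := by
      rw [Matrix.mul_sub, ← Matrix.mul_assoc, hRX, Matrix.zero_mul, sub_zero]
    rw [e, ← hdist, ← frobSq_transpose, ← frobSq_transpose (Q - X * C)]
    simp only [frobSq, Finset.mul_sum]
    refine Finset.sum_le_sum fun l _ => ?_
    have h := hdom (fun i => (Q - X * C) i l) k
    simp only [dotProduct, ← sq, Finset.mul_sum] at h
    refine le_trans (le_of_eq (Finset.sum_congr rfl fun j _ => ?_)) h
    congr 1
    simp only [transpose_apply, Matrix.mul_apply, vecMul, dotProduct]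
    exact Finset.sum_congr rfl fun i _ => mul_comm _ _
  rw [hsplit]
  rcases isEmpty_or_nonempty κ with hκ | hκ
  · have hd0 : d = 0 := by simpa using hd
    subst hd0
    simp [frobSq]
  -- With the least `μ k₀`, the total is at most `∑ μ k * s k + μ k₀ * ∑ (1 - s k)`, hence at most
  -- `∑ μ k` because `s k ≤ 1`.
  · obtain ⟨k₀, hk₀⟩ := Finite.exists_min μ
    have h1 : ∑ k, (μ k - μ k₀) * s k ≤ ∑ k, (μ k - μ k₀) :=
      Finset.sum_le_sum fun k _ => mul_le_of_le_one_right (sub_nonneg.2 (hk₀ k)) (hs1 k)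
    simp only [sub_mul, Finset.sum_sub_distrib, ← Finset.mul_sum, Finset.sum_const,
      Finset.card_univ, nsmul_eq_mul] at h1
    have h2 := hR k₀
    have h3 : μ k₀ * d ≤ μ k₀ * Fintype.card κ :=
      mul_le_mul_of_nonneg_left (by exact_mod_cast hd) (hμ k₀)
    linarith

/-- Unconstrained low-rank approximation has no spurious local minima. -/
theorem IsLocalMin.frobSq_le
    (h : IsLocalMin (fun p : Matrix α κ ℝ × Matrix β κ ℝ => frobSq (A - p.1 * p.2ᵀ)) (X, Y))
    (U : Matrix α κ ℝ) (V : Matrix β κ ℝ) : frobSq (A - X * Yᵀ) ≤ frobSq (A - U * Vᵀ) := by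
  classical
  by_cases hX : Function.Injective X.mulVec
  · obtain ⟨W, Z, μ, hZW, hWZ, hXW, hYZ⟩ := exists_orthogonal_factors X Y hX
    have hRY := IsLocalMin.residual_mul_eq_zero h
    have hRX := IsLocalMin.residual_transpose_mul_eq_zero h
    have h2 := IsLocalMin.rank_one_condition h
    set R := A - X * Yᵀ with hR
    refine frobSq_residual_le_of_dominated A R (X * W) (Y * Z) μ ?_ hXW hYZ ?_ ?_ ?_ U V
    · rw [transpose_mul, Matrix.mul_assoc, ← Matrix.mul_assoc W, hWZ, Matrix.one_mul, hR]
      abel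
    · rw [← Matrix.mul_assoc, hRY, Matrix.zero_mul]
    · rw [← Matrix.mul_assoc, hRX, Matrix.zero_mul]
    · intro u k
      -- For `p = u ᵥ* R` the cross term vanishes by `R Y = 0`, and the condition reads `2 ‖p‖² ≤ μ
      -- k ‖u‖² + ‖p‖²`.
      have h3 := h2 u (u ᵥ* R) (Z.col k) (W.col k)
      have e1 : Z.col k ⬝ᵥ W.col k = 1 := by
        have := congrFun (congrFun hZW k) k
        rwa [Matrix.mul_apply, Matrix.one_apply_eq] at this
      have e2 : (Y *ᵥ Z.col k) ⬝ᵥ (Y *ᵥ Z.col k) = μ k := by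
        have := congrFun (congrFun hYZ k) k
        rwa [Matrix.mul_apply, diagonal_apply_eq] at this
      have e3 : (X *ᵥ W.col k) ⬝ᵥ (X *ᵥ W.col k) = 1 := by
        have := congrFun (congrFun hXW k) k
        rwa [Matrix.mul_apply, Matrix.one_apply_eq] at this
      have e4 : (Y *ᵥ Z.col k) ⬝ᵥ (u ᵥ* R) = 0 := by
        rw [dotProduct_comm, ← dotProduct_mulVec, mulVec_mulVec, hRY, zero_mulVec,
          dotProduct_zero]
      rw [e1, e2, e3, e4, dotProduct_mulVec] at h3
      linarith
  · obtain ⟨v, hv, hv0⟩ : ∃ v : κ → ℝ, X *ᵥ v = 0 ∧ v ≠ 0 := by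
      by_contra hne
      push Not at hne
      exact hX ((injective_iff_map_eq_zero (X.mulVecLin)).2 hne)
    rw [IsLocalMin.residual_eq_zero_of_mulVec_eq_zero h hv0 hv]
    simpa [frobSq] using frobSq_nonneg (A - U * Vᵀ)

end LowRank

/-! ### Correcting the product inside the complete classes. -/

section Correction

variable {m n r : ℕ}

/-- A pair of matrices all of whose nonzero columns are indexed by `K`. -/
def ColumnsIn (K : Finset (Fin r))
    (d : Matrix (Fin m) (Fin r) ℝ × Matrix (Fin n) (Fin r) ℝ) : Prop :=
  (∀ i k, k ∉ K → d.1 i k = 0) ∧ ∀ j k, k ∉ K → d.2 j k = 0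

/-- The product `X Yᵀ` of a pair `(X, Y)`. -/
def pairProd (p : Matrix (Fin m) (Fin r) ℝ × Matrix (Fin n) (Fin r) ℝ) :
    Matrix (Fin m) (Fin n) ℝ :=
  p.1 * p.2ᵀ

theorem pairProd_apply (p : Matrix (Fin m) (Fin r) ℝ × Matrix (Fin n) (Fin r) ℝ) (i : Fin m)
    (j : Fin n) : pairProd p i j = ∑ k, p.1 i k * p.2 j k := by
  simp [pairProd, Matrix.mul_apply]

theorem pairProd_swap (p : Matrix (Fin m) (Fin r) ℝ × Matrix (Fin n) (Fin r) ℝ) :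
    pairProd p.swap = (pairProd p)ᵀ := by
  simp [pairProd]

theorem continuous_pairProd : Continuous
    (pairProd : Matrix (Fin m) (Fin r) ℝ × Matrix (Fin n) (Fin r) ℝ → _) := by
  unfold pairProd
  fun_prop

/-- The restriction of a matrix to a set of positions. -/
def restrictTo (S : Finset (Fin m × Fin n)) (D : Matrix (Fin m) (Fin n) ℝ) :
    Matrix (Fin m) (Fin n) ℝ :=
  Matrix.of fun i j => if (i, j) ∈ S then D i j else 0

theorem restrictTo_apply (S : Finset (Fin m × Fin n)) (D : Matrix (Fin m) (Fin n) ℝ) (i : Fin m)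
    (j : Fin n) : restrictTo S D i j = if (i, j) ∈ S then D i j else 0 := rfl

theorem continuous_restrictTo (S : Finset (Fin m × Fin n)) : Continuous (restrictTo S) := by
  refine continuous_matrix fun i j => ?_
  by_cases h : (i, j) ∈ S
  · simp only [restrictTo_apply, if_pos h]
    fun_prop
  · simp only [restrictTo_apply, if_neg h]
    fun_prop

theorem restrictTo_zero (S : Finset (Fin m × Fin n)) : restrictTo S 0 = 0 := by
  ext i j
  simp [restrictTo_apply]

theorem mem_of_restrictTo_ne_zero {S : Finset (Fin m × Fin n)} {D : Matrix (Fin m) (Fin n) ℝ}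
    (i : Fin m) (j : Fin n) (h : restrictTo S D i j ≠ 0) : (i, j) ∈ S := by
  by_contra hS
  exact h (by rw [restrictTo_apply, if_neg hS])

theorem loss_eq_sum (A : Matrix (Fin m) (Fin n) ℝ)
    (p : Matrix (Fin m) (Fin r) ℝ × Matrix (Fin n) (Fin r) ℝ) :
    loss A p = ∑ x : Fin m × Fin n, (A x.1 x.2 - pairProd p x.1 x.2) ^ 2 := by
  rw [Fintype.sum_prod_type]
  rfl

theorem loss_eq_sum_add_sum_compl (A : Matrix (Fin m) (Fin n) ℝ) (S : Finset (Fin m × Fin n))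
    (p : Matrix (Fin m) (Fin r) ℝ × Matrix (Fin n) (Fin r) ℝ) :
    loss A p = ∑ x ∈ S, (A x.1 x.2 - pairProd p x.1 x.2) ^ 2
      + ∑ x ∈ Sᶜ, (A x.1 x.2 - pairProd p x.1 x.2) ^ 2 := by
  rw [loss_eq_sum, Finset.sum_add_sum_compl]

variable {I : Finset (Fin m × Fin r)} {J : Finset (Fin n × Fin r)}

theorem add_mem_feasible {p q : Matrix (Fin m) (Fin r) ℝ × Matrix (Fin n) (Fin r) ℝ}
    (hp : p ∈ feasible I J) (hq : q ∈ feasible I J) : p + q ∈ feasible I J := by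
  constructor
  · intro i k h
    by_contra hI
    have h1 : p.1 i k = 0 := by_contra fun h' => hI (hp.1 i k h')
    have h2 : q.1 i k = 0 := by_contra fun h' => hI (hq.1 i k h')
    exact h (by simp [h1, h2])
  · intro i k h
    by_contra hI
    have h1 : p.2 i k = 0 := by_contra fun h' => hI (hp.2 i k h')
    have h2 : q.2 i k = 0 := by_contra fun h' => hI (hq.2 i k h')
    exact h (by simp [h1, h2])

theorem swap_mem_feasible {p : Matrix (Fin m) (Fin r) ℝ × Matrix (Fin n) (Fin r) ℝ}
    (hp : p ∈ feasible I J) : p.swap ∈ feasible J I :=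
  ⟨hp.2, hp.1⟩

/-- Perturbations of disjoint sets of columns change the product independently. -/
theorem pairProd_add_add (p : Matrix (Fin m) (Fin r) ℝ × Matrix (Fin n) (Fin r) ℝ)
    {K K' : Finset (Fin r)} {d d' : Matrix (Fin m) (Fin r) ℝ × Matrix (Fin n) (Fin r) ℝ}
    (hd : ColumnsIn K d) (hd' : ColumnsIn K' d') (hK : Disjoint K K') :
    pairProd (p + (d + d')) = pairProd (p + d) + pairProd (p + d') - pairProd p := by
  ext i j
  simp only [Matrix.add_apply, Matrix.sub_apply, pairProd_apply, ← Finset.sum_add_distrib,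
    ← Finset.sum_sub_distrib, Prod.fst_add, Prod.snd_add]
  refine Finset.sum_congr rfl fun k _ => ?_
  by_cases hk : k ∈ K
  · have hk' : k ∉ K' := Finset.disjoint_left.1 hK hk
    rw [hd'.1 i k hk', hd'.2 j k hk']
    ring
  · rw [hd.1 i k hk, hd.2 j k hk]
    ring

/-- Every change of the product supported in `S` can be realized by a feasible perturbation of
the columns in `K` that depends continuously on it. -/
def HasCorrection (I : Finset (Fin m × Fin r)) (J : Finset (Fin n × Fin r))
    (p : Matrix (Fin m) (Fin r) ℝ × Matrix (Fin n) (Fin r) ℝ) (K : Finset (Fin r))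
    (S : Finset (Fin m × Fin n)) : Prop :=
  ∃ c : Matrix (Fin m) (Fin n) ℝ → Matrix (Fin m) (Fin r) ℝ × Matrix (Fin n) (Fin r) ℝ,
    Continuous c ∧ c 0 = 0 ∧ (∀ D, c D ∈ feasible I J) ∧ (∀ D, ColumnsIn K (c D)) ∧
      ∀ D, (∀ i j, D i j ≠ 0 → (i, j) ∈ S) → pairProd (p + c D) = pairProd p + D

theorem hasCorrection_empty (p : Matrix (Fin m) (Fin r) ℝ × Matrix (Fin n) (Fin r) ℝ) :
    HasCorrection I J p ∅ ∅ := by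
  refine ⟨fun _ => 0, continuous_const, rfl, fun D => ?_, fun D => ?_, fun D hD => ?_⟩
  · simp [feasible]
  · simp [ColumnsIn]
  · have : D = 0 := by
      ext i j
      by_contra h
      simpa using hD i j h
    simp [this]

/-- The column sets must be disjoint, but the position sets may overlap: a change is split into its
part on `S` and its part on `S₂ \ S`, so nothing is corrected twice. -/
theorem HasCorrection.union {p : Matrix (Fin m) (Fin r) ℝ × Matrix (Fin n) (Fin r) ℝ}
    {K K₂ : Finset (Fin r)} {S S₂ : Finset (Fin m × Fin n)} (h : HasCorrection I J p K S)
    (h' : HasCorrection I J p K₂ S₂) (hK : Disjoint K K₂) :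
    HasCorrection I J p (K ∪ K₂) (S ∪ S₂) := by
  obtain ⟨c, hc, hc0, hcf, hcc, hcp⟩ := h
  obtain ⟨c', hc', hc0', hcf', hcc', hcp'⟩ := h'
  refine ⟨fun D => c (restrictTo S D) + c' (restrictTo (S₂ \ S) D), ?_, ?_, fun D => ?_,
    fun D => ?_, fun D hD => ?_⟩
  · exact (hc.comp (continuous_restrictTo S)).add (hc'.comp (continuous_restrictTo _))
  · simp only [restrictTo_zero, hc0, hc0', add_zero]
  · exact add_mem_feasible (hcf _) (hcf' _)
  · constructor
    · intro i k hk
      rw [Finset.mem_union, not_or] at hk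
      simp [(hcc (restrictTo S D)).1 i k hk.1, (hcc' (restrictTo (S₂ \ S) D)).1 i k hk.2]
    · intro i k hk
      rw [Finset.mem_union, not_or] at hk
      simp [(hcc (restrictTo S D)).2 i k hk.1, (hcc' (restrictTo (S₂ \ S) D)).2 i k hk.2]
  · rw [pairProd_add_add p (hcc _) (hcc' _) hK, hcp _ mem_of_restrictTo_ne_zero,
      hcp' (restrictTo (S₂ \ S) D) fun i j hij =>
        (Finset.mem_sdiff.1 (mem_of_restrictTo_ne_zero i j hij)).1]
    ext i j
    have : D i j = restrictTo S D i j + restrictTo (S₂ \ S) D i j := by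
      simp only [restrictTo_apply, Finset.mem_sdiff]
      by_cases h1 : (i, j) ∈ S
      · simp [h1]
      · by_cases h2 : (i, j) ∈ S₂
        · simp [h1, h2]
        · have h0 : D i j = 0 := by
            by_contra h0
            exact (Finset.mem_union.1 (hD i j h0)).elim h1 h2
          simp [h1, h2, h0]
    simp only [Matrix.add_apply, Matrix.sub_apply, this]
    ring

theorem HasCorrection.biUnion {p : Matrix (Fin m) (Fin r) ℝ × Matrix (Fin n) (Fin r) ℝ}
    {S : Finset (Fin r) → Finset (Fin m × Fin n)} (𝓒 : Finset (Finset (Fin r)))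
    (hd : ∀ P ∈ 𝓒, ∀ P' ∈ 𝓒, P ≠ P' → Disjoint P P')
    (h : ∀ P ∈ 𝓒, HasCorrection I J p P (S P)) :
    HasCorrection I J p (𝓒.biUnion id) (𝓒.biUnion S) := by
  induction 𝓒 using Finset.induction_on with
  | empty => exact hasCorrection_empty p
  | insert P 𝓒 hP ih =>
    rw [Finset.biUnion_insert, Finset.biUnion_insert]
    refine (h P (Finset.mem_insert_self _ _)).union (ih (fun P₁ h₁ P₂ h₂ => hd P₁
      (Finset.mem_insert_of_mem h₁) P₂ (Finset.mem_insert_of_mem h₂))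
      fun P' h' => h P' (Finset.mem_insert_of_mem h')) ?_
    rw [Finset.disjoint_biUnion_right]
    exact fun P' h' => hd P (Finset.mem_insert_self _ _) P' (Finset.mem_insert_of_mem h')
      fun e => hP (e ▸ h')

theorem HasCorrection.swap {p : Matrix (Fin m) (Fin r) ℝ × Matrix (Fin n) (Fin r) ℝ}
    {K : Finset (Fin r)} {R : Finset (Fin m)} {C : Finset (Fin n)}
    (h : HasCorrection I J p K (R ×ˢ C)) : HasCorrection J I p.swap K (C ×ˢ R) := by
  obtain ⟨c, hc, hc0, hcf, hcc, hcp⟩ := h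
  refine ⟨fun D => (c Dᵀ).swap, ?_, ?_, fun D => swap_mem_feasible (hcf _),
    fun D => ⟨(hcc _).2, (hcc _).1⟩, fun D hD => ?_⟩
  · exact continuous_swap.comp (hc.comp (by fun_prop))
  · simp [hc0]
  · rw [← Prod.swap_add, pairProd_swap, hcp, transpose_add, transpose_transpose, pairProd_swap]
    intro i j hij
    have := hD j i hij
    rw [Finset.mem_product] at this ⊢
    exact this.symm

/-- `P` is a set of columns that are free on the rows `R`, respectively `C`, of the two factors,
and whose rank-one supports are all equal to `R × C`. -/
structure IsBlock (I : Finset (Fin m × Fin r)) (J : Finset (Fin n × Fin r)) (P : Finset (Fin r))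
    (R : Finset (Fin m)) (C : Finset (Fin n)) : Prop where
  rows : ∀ k ∈ P, ∀ i ∈ R, (i, k) ∈ I
  cols : ∀ k ∈ P, ∀ j ∈ C, (j, k) ∈ J
  full : (R = ∅ ∧ C = ∅) ∨
    ((∀ k ∈ P, ∀ i, (i, k) ∈ I → i ∈ R) ∧ ∀ k ∈ P, ∀ j, (j, k) ∈ J → j ∈ C)

theorem IsBlock.swap {P : Finset (Fin r)} {R : Finset (Fin m)} {C : Finset (Fin n)}
    (h : IsBlock I J P R C) : IsBlock J I P C R :=
  ⟨h.cols, h.rows, h.full.imp And.symm And.symm⟩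

theorem mem_rankOneSupport {k : Fin r} {x : Fin m × Fin n} :
    x ∈ rankOneSupport I J k ↔ (x.1, k) ∈ I ∧ (x.2, k) ∈ J := by
  simp [rankOneSupport]

theorem classSupport_eq_of_mem {P : Finset (Fin r)} (hP : P ∈ classes I J) {k : Fin r}
    (hk : k ∈ P) : classSupport I J P = rankOneSupport I J k := by
  obtain ⟨l, -, rfl⟩ := Finset.mem_image.1 hP
  rw [Finset.mem_filter] at hk
  ext x
  simp only [classSupport, Finset.mem_biUnion, Finset.mem_filter, Finset.mem_univ, true_and]
  exact ⟨fun ⟨a, ha, hx⟩ => by rwa [hk.2, ← ha], fun hx => ⟨k, hk.2, hx⟩⟩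

theorem nonempty_of_mem_classes {P : Finset (Fin r)} (hP : P ∈ classes I J) : P.Nonempty := by
  obtain ⟨l, -, rfl⟩ := Finset.mem_image.1 hP
  exact ⟨l, by simp⟩

theorem disjoint_of_mem_classes {P P' : Finset (Fin r)} (hP : P ∈ classes I J)
    (hP' : P' ∈ classes I J) (hne : P ≠ P') : Disjoint P P' := by
  rw [Finset.disjoint_left]
  intro k hk hk'
  apply hne
  obtain ⟨l, -, rfl⟩ := Finset.mem_image.1 hP
  obtain ⟨l', -, rfl⟩ := Finset.mem_image.1 hP'
  simp only [Finset.mem_filter, Finset.mem_univ, true_and] at hk hk'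
  rw [← hk, ← hk']

/-- If the class support is empty, one of the two column supports may still be nonempty although
`R_P` and `C_P` are empty; this is the first alternative of `full`. -/
theorem isBlock_of_mem_classes {P : Finset (Fin r)} (hP : P ∈ classes I J) :
    IsBlock I J P (classRows I J P) (classCols I J P) := by
  have key : ∀ k ∈ P, ∀ i j, (i, j) ∈ classSupport I J P ↔ (i, k) ∈ I ∧ (j, k) ∈ J := by
    intro k hk i j
    rw [classSupport_eq_of_mem hP hk, mem_rankOneSupport]
  refine ⟨fun k hk i hi => ?_, fun k hk j hj => ?_, ?_⟩
  · obtain ⟨x, hx, rfl⟩ := Finset.mem_image.1 hi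
    exact ((key k hk _ _).1 hx).1
  · obtain ⟨x, hx, rfl⟩ := Finset.mem_image.1 hj
    exact ((key k hk _ _).1 hx).2
  · rcases (classSupport I J P).eq_empty_or_nonempty with h | ⟨⟨i₀, j₀⟩, h⟩
    · left
      simp [classRows, classCols, h]
    · right
      refine ⟨fun k hk i hi => ?_, fun k hk j hj => ?_⟩
      · exact Finset.mem_image.2 ⟨(i, j₀), (key k hk _ _).2 ⟨hi, ((key k hk _ _).1 h).2⟩, rfl⟩
      · exact Finset.mem_image.2 ⟨(i₀, j), (key k hk _ _).2 ⟨((key k hk _ _).1 h).1, hj⟩, rfl⟩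

theorem classSupport_eq_product {P : Finset (Fin r)} (hP : P ∈ classes I J) :
    classSupport I J P = classRows I J P ×ˢ classCols I J P := by
  obtain ⟨k, hk⟩ := nonempty_of_mem_classes hP
  have hB := isBlock_of_mem_classes hP
  ext ⟨i, j⟩
  rw [Finset.mem_product]
  constructor
  · intro h
    exact ⟨Finset.mem_image.2 ⟨_, h, rfl⟩, Finset.mem_image.2 ⟨_, h, rfl⟩⟩
  · intro h
    rw [classSupport_eq_of_mem hP hk, mem_rankOneSupport]
    exact ⟨hB.rows k hk i h.1, hB.cols k hk j h.2⟩

theorem SubFullRowRank.exists_right_inverse {d : ℕ} {M : Matrix (Fin d) (Fin r) ℝ}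
    {R : Finset (Fin d)} {P : Finset (Fin r)} (h : SubFullRowRank M R P) :
    ∃ G : Matrix P R ℝ, M.submatrix (fun i : R => (i : Fin d)) (fun k : P => (k : Fin r)) * G
      = 1 := by
  refine mulVec_surjective_iff_exists_right_inverse.1 ?_
  have : LinearMap.range (M.submatrix (fun i : R => (i : Fin d))
      (fun k : P => (k : Fin r))).mulVecLin = ⊤ := by
    apply Submodule.eq_top_of_finrank_eq
    rw [Module.finrank_fintype_fun_eq_card, Fintype.card_coe]
    exact h
  exact LinearMap.range_eq_top.1 this

/-- With `X_{R,P} G = 1`, adding `(G D)ᵀ` to `Y_{C,P}` changes the product by `D`. Since `X` stays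
fixed, there is no quadratic term. -/
theorem IsBlock.hasCorrection_of_left {P : Finset (Fin r)} {R : Finset (Fin m)}
    {C : Finset (Fin n)} (hB : IsBlock I J P R C)
    {p : Matrix (Fin m) (Fin r) ℝ × Matrix (Fin n) (Fin r) ℝ} (hp : p ∈ feasible I J)
    (hrank : SubFullRowRank p.1 R P) : HasCorrection I J p P (R ×ˢ C) := by
  obtain ⟨G, hG⟩ := hrank.exists_right_inverse
  let e : Matrix (Fin m) (Fin n) ℝ → Matrix (Fin n) (Fin r) ℝ := fun D => Matrix.of fun j k =>
    if h : k ∈ P ∧ j ∈ C then ∑ i : R, G ⟨k, h.1⟩ i * D i j else 0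
  have he : ∀ D j k, e D j k =
      if h : k ∈ P ∧ j ∈ C then ∑ i : R, G ⟨k, h.1⟩ i * D i j else 0 := fun _ _ _ => rfl
  refine ⟨fun D => (0, e D), ?_, ?_, fun D => ⟨?_, ?_⟩, fun D => ⟨?_, ?_⟩, fun D hD => ?_⟩
  · refine continuous_const.prodMk (continuous_matrix fun j k => ?_)
    by_cases h : k ∈ P ∧ j ∈ C
    · simp only [he, dif_pos h]
      fun_prop
    · simp only [he, dif_neg h]
      fun_prop
  · refine Prod.ext rfl ?_
    ext j k
    simp [he]
  · intro i k h
    exact absurd rfl h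
  · intro j k h
    by_cases h' : k ∈ P ∧ j ∈ C
    · exact hB.cols k h'.1 j h'.2
    · exact absurd (by simp only [he, dif_neg h']) h
  · intro i k _
    rfl
  · intro j k h
    have h' : ¬ (k ∈ P ∧ j ∈ C) := fun h' => h h'.1
    simp only [he, dif_neg h']
  · have : pairProd (p + (0, e D)) = pairProd p + p.1 * (e D)ᵀ := by
      simp [pairProd, Matrix.mul_add]
    rw [this]
    congr 1
    ext i j
    simp only [Matrix.mul_apply, Matrix.transpose_apply]
    by_cases hj : j ∈ C
    · have h1 : ∑ k, p.1 i k * e D j k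
          = ∑ k : P, p.1 i k * ∑ i' : R, G k i' * D i' j := by
        rw [← Finset.sum_subset (Finset.subset_univ P), ← Finset.sum_coe_sort P]
        · refine Finset.sum_congr rfl fun k _ => ?_
          rw [he, dif_pos ⟨k.2, hj⟩]
        · intro k _ hk
          rw [he, dif_neg fun h => hk h.1, mul_zero]
      rw [h1]
      by_cases hi : i ∈ R
      · have h2 : ∑ k : P, p.1 i k * ∑ i' : R, G k i' * D i' j
            = ∑ i' : R, (p.1.submatrix (fun i : R => (i : Fin m)) (fun k : P => (k : Fin r)) * G)
              ⟨i, hi⟩ i' * D i' j := by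
          simp only [Finset.mul_sum, Matrix.mul_apply, Finset.sum_mul, submatrix_apply]
          rw [Finset.sum_comm]
          exact Finset.sum_congr rfl fun _ _ => Finset.sum_congr rfl fun _ _ => by ring
        rw [h2, hG]
        simp [Matrix.one_apply]
      · have h0 : D i j = 0 := by
          by_contra h0
          exact hi (Finset.mem_product.1 (hD i j h0)).1
        rw [h0]
        refine Finset.sum_eq_zero fun k _ => ?_
        -- Rows outside `R` must not be disturbed: the `P`-columns of `X` vanish there, unless `C`
        -- is empty.
        rcases hB.full with h | h
        · exact absurd hj (by simp [h.2])
        · have : p.1 i k = 0 := by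
            by_contra h3
            exact hi (h.1 k k.2 i (hp.1 i k h3))
          rw [this, zero_mul]
    · have h0 : D i j = 0 := by
        by_contra h0
        exact hj (Finset.mem_product.1 (hD i j h0)).2
      rw [h0]
      refine Finset.sum_eq_zero fun k _ => ?_
      rw [he, dif_neg fun h => hj h.2, mul_zero]

/-- A CEC-full-rank pair can absorb every change of the product inside the complete classes. -/
theorem CECFullRank.hasCorrection
    {p : Matrix (Fin m) (Fin r) ℝ × Matrix (Fin n) (Fin r) ℝ} (hp : p ∈ feasible I J)
    (h : CECFullRank I J p) :
    HasCorrection I J p (completeIndices I J) (completeSupport I J) := by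
  have hcl : ∀ P ∈ completeClasses I J, P ∈ classes I J := fun P hP => (Finset.mem_filter.1 hP).1
  refine HasCorrection.biUnion _ (fun P hP P' hP' => disjoint_of_mem_classes (hcl P hP)
    (hcl P' hP')) fun P hP => ?_
  rw [classSupport_eq_product (hcl P hP)]
  have hB := isBlock_of_mem_classes (hcl P hP)
  rcases h P hP with h | h
  · exact hB.hasCorrection_of_left hp h
  · exact (hB.swap.hasCorrection_of_left (swap_mem_feasible hp) h).swap

/-- At a local minimum the residual vanishes wherever the product can be corrected. -/
theorem HasCorrection.residual_eq_zero {A : Matrix (Fin m) (Fin n) ℝ}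
    {p : Matrix (Fin m) (Fin r) ℝ × Matrix (Fin n) (Fin r) ℝ} {K : Finset (Fin r)}
    {S : Finset (Fin m × Fin n)} (h : HasCorrection I J p K S) (hp : p ∈ feasible I J)
    (hmin : IsLocalMinOn (loss A) (feasible I J) p) {x : Fin m × Fin n} (hx : x ∈ S) :
    A x.1 x.2 - pairProd p x.1 x.2 = 0 := by
  obtain ⟨c, hc, hc0, hcf, hcc, hcp⟩ := h
  set E := restrictTo S (A - pairProd p) with hE
  have hcont : Tendsto (fun t : ℝ => p + c (t • E)) (𝓝 0) (𝓝[feasible I J] p) := by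
    refine tendsto_nhdsWithin_iff.2 ⟨?_, Eventually.of_forall fun t =>
      add_mem_feasible hp (hcf _)⟩
    have : Continuous (fun t : ℝ => p + c (t • E)) := by fun_prop
    simpa [hc0] using this.tendsto 0
  have h1 := hcont.eventually hmin
  set q := ∑ x ∈ S, (A x.1 x.2 - pairProd p x.1 x.2) ^ 2 with hq
  -- Moving the product by `t E` scales the residual on `S` by `1 - t`, so the first-order
  -- coefficient is `-2 q`.
  have h2 : ∀ t : ℝ, loss A (p + c (t • E)) = loss A p + (t * (-2 * q) + t ^ 2 * q) := by
    intro t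
    have hprod : pairProd (p + c (t • E)) = pairProd p + t • E :=
      hcp _ fun i j hij => mem_of_restrictTo_ne_zero i j (right_ne_zero_of_mul hij)
    rw [loss_eq_sum_add_sum_compl A S, loss_eq_sum_add_sum_compl A S p, ← hq, hprod]
    have e1 : ∑ x ∈ S, (A x.1 x.2 - (pairProd p + t • E) x.1 x.2) ^ 2 = (1 - t) ^ 2 * q := by
      rw [hq, Finset.mul_sum]
      refine Finset.sum_congr rfl fun x hx => ?_
      have : E x.1 x.2 = A x.1 x.2 - pairProd p x.1 x.2 := by
        rw [hE, restrictTo_apply, if_pos hx, Matrix.sub_apply]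
      rw [Matrix.add_apply, Matrix.smul_apply, this, smul_eq_mul]
      ring
    have e2 : ∑ x ∈ Sᶜ, (A x.1 x.2 - (pairProd p + t • E) x.1 x.2) ^ 2
        = ∑ x ∈ Sᶜ, (A x.1 x.2 - pairProd p x.1 x.2) ^ 2 := by
      refine Finset.sum_congr rfl fun x hx => ?_
      have : E x.1 x.2 = 0 := by
        rw [hE, restrictTo_apply, if_neg (Finset.mem_compl.1 hx)]
      rw [Matrix.add_apply, Matrix.smul_apply, this, smul_zero, add_zero]
    rw [e1, e2]
    ring
  have h3 : -2 * q = 0 := (quadratic_conditions (b := q) (c := 0) (d := 0) (by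
    filter_upwards [h1] with t ht
    rw [h2] at ht
    linarith [show t ^ 2 * (q + t * (0 + t * 0)) = t ^ 2 * q by ring])).1
  have h4 : q = 0 := by linarith
  have h5 := (Finset.sum_eq_zero_iff_of_nonneg fun x _ => sq_nonneg _).1 h4 x hx
  simpa using h5

end Correction

/-! ### Reduction to unconstrained problems on disjoint rectangles. -/

section Blocks

variable {m n r : ℕ} {I : Finset (Fin m × Fin r)} {J : Finset (Fin n × Fin r)}

/-- The loss of a feasible pair on a rectangle `R × C` met only by the columns in `Q` is the loss
of an unconstrained factorization problem. -/
theorem sum_product_eq_frobSq {A : Matrix (Fin m) (Fin n) ℝ} {Q : Finset (Fin r)}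
    {R : Finset (Fin m)} {C : Finset (Fin n)}
    (hsep : ∀ k ∉ Q, ∀ i ∈ R, ∀ j ∈ C, (i, k) ∈ I → (j, k) ∉ J)
    {q : Matrix (Fin m) (Fin r) ℝ × Matrix (Fin n) (Fin r) ℝ} (hq : q ∈ feasible I J) :
    ∑ x ∈ R ×ˢ C, (A x.1 x.2 - pairProd q x.1 x.2) ^ 2 =
      frobSq (A.submatrix (fun i : R => (i : Fin m)) (fun j : C => (j : Fin n)) -
        q.1.submatrix (fun i : R => (i : Fin m)) (fun k : Q => (k : Fin r)) *
          (q.2.submatrix (fun j : C => (j : Fin n)) (fun k : Q => (k : Fin r)))ᵀ) := by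
  rw [Finset.sum_product, ← Finset.sum_coe_sort R]
  refine Finset.sum_congr rfl fun i _ => ?_
  rw [← Finset.sum_coe_sort C]
  refine Finset.sum_congr rfl fun j _ => ?_
  rw [Matrix.sub_apply, Matrix.mul_apply, pairProd_apply,
    ← Finset.sum_subset (Finset.subset_univ Q), ← Finset.sum_coe_sort Q]
  · rfl
  · intro k _ hk
    by_contra h
    exact hsep k hk i i.2 j j.2 (hq.1 i k (left_ne_zero_of_mul h))
      (hq.2 j k (right_ne_zero_of_mul h))

/-- At a local minimum, the loss on a rectangle `R × C` that is met only by the columns in `Q`,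
outside the set `S` of correctable positions, is minimal. -/
theorem HasCorrection.sum_product_le {A : Matrix (Fin m) (Fin n) ℝ}
    {p : Matrix (Fin m) (Fin r) ℝ × Matrix (Fin n) (Fin r) ℝ} {K Q : Finset (Fin r)}
    {S : Finset (Fin m × Fin n)} {R : Finset (Fin m)} {C : Finset (Fin n)}
    (hcor : HasCorrection I J p K S) (hp : p ∈ feasible I J)
    (hmin : IsLocalMinOn (loss A) (feasible I J) p) (hQK : Disjoint Q K)
    (hrows : ∀ k ∈ Q, ∀ i ∈ R, (i, k) ∈ I) (hcols : ∀ k ∈ Q, ∀ j ∈ C, (j, k) ∈ J)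
    (hsep : ∀ k ∉ Q, ∀ i ∈ R, ∀ j ∈ C, (i, k) ∈ I → (j, k) ∉ J)
    (hsub : ∀ k ∈ Q, ∀ i j, (i, k) ∈ I → (j, k) ∈ J → (i, j) ∉ S → (i, j) ∈ R ×ˢ C)
    {p' : Matrix (Fin m) (Fin r) ℝ × Matrix (Fin n) (Fin r) ℝ} (hp' : p' ∈ feasible I J) :
    ∑ x ∈ R ×ˢ C, (A x.1 x.2 - pairProd p x.1 x.2) ^ 2 ≤
      ∑ x ∈ R ×ˢ C, (A x.1 x.2 - pairProd p' x.1 x.2) ^ 2 := by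
  obtain ⟨c, hc, hc0, hcf, hcc, hcp⟩ := hcor
  rw [sum_product_eq_frobSq hsep hp, sum_product_eq_frobSq hsep hp']
  let resX : Matrix (Fin m) (Fin r) ℝ → Matrix R Q ℝ := fun X =>
    X.submatrix (fun i : R => (i : Fin m)) (fun k : Q => (k : Fin r))
  let resY : Matrix (Fin n) (Fin r) ℝ → Matrix C Q ℝ := fun Y =>
    Y.submatrix (fun j : C => (j : Fin n)) (fun k : Q => (k : Fin r))
  -- `δ W` replaces the free blocks of `p` by `W`, `D W` cancels its effect on `S`, and `Φ W` is the
  -- corrected pair. The correction avoids the columns `Q`, so the blocks of `Φ W` are exactly `W`.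
  let δ : Matrix R Q ℝ × Matrix C Q ℝ → Matrix (Fin m) (Fin r) ℝ × Matrix (Fin n) (Fin r) ℝ :=
    fun W => (Matrix.of fun i k => if h : i ∈ R ∧ k ∈ Q then
        W.1 ⟨i, h.1⟩ ⟨k, h.2⟩ - p.1 i k else 0,
      Matrix.of fun j k => if h : j ∈ C ∧ k ∈ Q then
        W.2 ⟨j, h.1⟩ ⟨k, h.2⟩ - p.2 j k else 0)
  have hδ1 : ∀ W i k, (δ W).1 i k = if h : i ∈ R ∧ k ∈ Q then
    W.1 ⟨i, h.1⟩ ⟨k, h.2⟩ - p.1 i k else 0 := fun _ _ _ => rfl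
  have hδ2 : ∀ W j k, (δ W).2 j k = if h : j ∈ C ∧ k ∈ Q then
    W.2 ⟨j, h.1⟩ ⟨k, h.2⟩ - p.2 j k else 0 := fun _ _ _ => rfl
  have hδcont : Continuous δ := by
    refine Continuous.prodMk (continuous_matrix fun i k => ?_) (continuous_matrix fun j k => ?_)
    · by_cases h : i ∈ R ∧ k ∈ Q
      · simp only [of_apply, dif_pos h]
        exact (continuous_fst.matrix_elem _ _).sub continuous_const
      · simp only [of_apply, dif_neg h]
        exact continuous_const
    · by_cases h : j ∈ C ∧ k ∈ Q
      · simp only [of_apply, dif_pos h]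
        exact (continuous_snd.matrix_elem _ _).sub continuous_const
      · simp only [of_apply, dif_neg h]
        exact continuous_const
  have hδcol : ∀ W, ColumnsIn Q (δ W) := fun W =>
    ⟨fun i k hk => by rw [hδ1, dif_neg fun h => hk h.2],
      fun j k hk => by rw [hδ2, dif_neg fun h => hk h.2]⟩
  have hδf : ∀ W, δ W ∈ feasible I J := by
    refine fun W => ⟨fun i k h => ?_, fun j k h => ?_⟩
    · by_cases h' : i ∈ R ∧ k ∈ Q
      · exact hrows k h'.2 i h'.1
      · exact absurd (by rw [hδ1, dif_neg h']) h
    · by_cases h' : j ∈ C ∧ k ∈ Q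
      · exact hcols k h'.2 j h'.1
      · exact absurd (by rw [hδ2, dif_neg h']) h
  have hδ0 : δ (resX p.1, resY p.2) = 0 := by
    refine Prod.ext ?_ ?_
    · ext i k
      rw [hδ1]
      split_ifs <;> simp [resX]
    · ext j k
      rw [hδ2]
      split_ifs <;> simp [resY]
  let D : Matrix R Q ℝ × Matrix C Q ℝ → Matrix (Fin m) (Fin n) ℝ := fun W =>
    restrictTo S (pairProd p - pairProd (p + δ W))
  have hDcont : Continuous D := (continuous_restrictTo S).comp
    (continuous_const.sub (continuous_pairProd.comp (continuous_const.add hδcont)))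
  let Φ : Matrix R Q ℝ × Matrix C Q ℝ → Matrix (Fin m) (Fin r) ℝ × Matrix (Fin n) (Fin r) ℝ :=
    fun W => p + (δ W + c (D W))
  have hΦf : ∀ W, Φ W ∈ feasible I J := fun W =>
    add_mem_feasible hp (add_mem_feasible (hδf W) (hcf _))
  have hΦcont : Continuous Φ := continuous_const.add (hδcont.add (hc.comp hDcont))
  have hΦ0 : Φ (resX p.1, resY p.2) = p := by
    simp [Φ, D, hδ0, restrictTo_zero, hc0]
  have hΦX : ∀ W, resX (Φ W).1 = W.1 := by
    intro W
    ext i k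
    have h0 := (hcc (D W)).1 i k (Finset.disjoint_left.1 hQK k.2)
    have h1 : (δ W).1 i k = W.1 i k - p.1 i k := by rw [hδ1, dif_pos ⟨i.2, k.2⟩]
    change p.1 i k + ((δ W).1 i k + (c (D W)).1 i k) = W.1 i k
    rw [h0, h1]
    ring
  have hΦY : ∀ W, resY (Φ W).2 = W.2 := by
    intro W
    ext j k
    have h0 := (hcc (D W)).2 j k (Finset.disjoint_left.1 hQK k.2)
    have h1 : (δ W).2 j k = W.2 j k - p.2 j k := by rw [hδ2, dif_pos ⟨j.2, k.2⟩]
    change p.2 j k + ((δ W).2 j k + (c (D W)).2 j k) = W.2 j k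
    rw [h0, h1]
    ring
  -- Outside `R × C` the product is unchanged: on `S` by the correction, off `S` because no column
  -- of `Q` reaches such a position.
  have hΦprod : ∀ W, ∀ x ∈ (R ×ˢ C)ᶜ, pairProd (Φ W) x.1 x.2 = pairProd p x.1 x.2 := by
    rintro W ⟨i, j⟩ hx
    have e : pairProd (Φ W) = pairProd (p + δ W) + D W := by
      have : pairProd (p + c (D W)) = pairProd p + D W := hcp _ mem_of_restrictTo_ne_zero
      rw [show Φ W = p + (δ W + c (D W)) from rfl,
        pairProd_add_add p (hδcol W) (hcc _) hQK, this]
      abel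
    rw [e, Matrix.add_apply]
    by_cases hS : (i, j) ∈ S
    · rw [show D W i j = pairProd p i j - pairProd (p + δ W) i j by
        simp only [D, restrictTo_apply, if_pos hS, Matrix.sub_apply]]
      ring
    · rw [show D W i j = 0 by simp only [D, restrictTo_apply, if_neg hS], add_zero,
        pairProd_apply, pairProd_apply]
      refine Finset.sum_congr rfl fun k _ => ?_
      by_cases hk : k ∈ Q
      · have hzero : ∀ q ∈ feasible I J, q.1 i k * q.2 j k = 0 := by
          intro q hq
          by_contra h
          exact Finset.mem_compl.1 hx (hsub k hk i j (hq.1 i k (left_ne_zero_of_mul h))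
            (hq.2 j k (right_ne_zero_of_mul h)) hS)
        rw [hzero p hp]
        exact hzero _ (add_mem_feasible hp (hδf W))
      · change (p.1 i k + (δ W).1 i k) * (p.2 j k + (δ W).2 j k) = _
        rw [(hδcol W).1 i k hk, (hδcol W).2 j k hk, add_zero, add_zero]
  have hloc : IsLocalMin (fun W : Matrix R Q ℝ × Matrix C Q ℝ =>
      frobSq (A.submatrix (fun i : R => (i : Fin m)) (fun j : C => (j : Fin n)) - W.1 * W.2ᵀ))
      (resX p.1, resY p.2) := by
    have ht : Tendsto Φ (𝓝 (resX p.1, resY p.2)) (𝓝[feasible I J] p) := by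
      refine tendsto_nhdsWithin_iff.2 ⟨?_, Eventually.of_forall hΦf⟩
      simpa [hΦ0] using hΦcont.tendsto (resX p.1, resY p.2)
    filter_upwards [ht.eventually hmin] with W hW
    have hcompl : ∑ x ∈ (R ×ˢ C)ᶜ, (A x.1 x.2 - pairProd (Φ W) x.1 x.2) ^ 2
        = ∑ x ∈ (R ×ˢ C)ᶜ, (A x.1 x.2 - pairProd p x.1 x.2) ^ 2 :=
      Finset.sum_congr rfl fun x hx => by rw [hΦprod W x hx]
    rw [loss_eq_sum_add_sum_compl A (R ×ˢ C), loss_eq_sum_add_sum_compl A (R ×ˢ C) (Φ W),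
      sum_product_eq_frobSq hsep hp, sum_product_eq_frobSq hsep (hΦf W),
      hcompl] at hW
    have h1 := hΦX W
    have h2 := hΦY W
    simp only [resX, resY] at h1 h2
    rw [h1, h2] at hW
    exact le_of_add_le_add_right hW
  exact IsLocalMin.frobSq_le hloc _ _

/-- Under the rectangularity and disjointness assumptions, a CEC-full-rank local minimum is a
global minimum. -/
theorem CECFullRank.isMinOn
    (hrect : ∀ k, k ∉ completeIndices I J → IsRectangular (outsideSupport I J k))
    (hdisj : ∀ k l, k ∉ completeIndices I J → l ∉ completeIndices I J →
      outsideSupport I J k = outsideSupport I J l ∨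
        Disjoint (outsideSupport I J k) (outsideSupport I J l))
    {A : Matrix (Fin m) (Fin n) ℝ} {p : Matrix (Fin m) (Fin r) ℝ × Matrix (Fin n) (Fin r) ℝ}
    (hp : p ∈ feasible I J) (hfull : CECFullRank I J p)
    (hmin : IsLocalMinOn (loss A) (feasible I J) p) : IsMinOn (loss A) (feasible I J) p := by
  intro p' hp'
  have hcor := hfull.hasCorrection hp
  set T := completeIndices I J with hT
  set S := completeSupport I J with hS
  have hTS : ∀ k ∈ T, ∀ x ∈ rankOneSupport I J k, x ∈ S := by
    intro k hk x hx
    obtain ⟨P, hP, hkP⟩ := Finset.mem_biUnion.1 hk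
    exact Finset.mem_biUnion.2 ⟨P, hP, Finset.mem_biUnion.2 ⟨k, hkP, hx⟩⟩
  have hmem : ∀ {k} {x : Fin m × Fin n}, x ∈ outsideSupport I J k ↔
      ((x.1, k) ∈ I ∧ (x.2, k) ∈ J) ∧ x ∉ S := by
    intro k x
    rw [outsideSupport, Finset.mem_sdiff, mem_rankOneSupport]
  let F : Finset (Finset (Fin m × Fin n)) := Tᶜ.image (outsideSupport I J)
  have hblock : ∀ B ∈ F, ∑ x ∈ B, (A x.1 x.2 - pairProd p x.1 x.2) ^ 2 ≤
      ∑ x ∈ B, (A x.1 x.2 - pairProd p' x.1 x.2) ^ 2 := by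
    intro B hB
    obtain ⟨k₀, hk₀, rfl⟩ := Finset.mem_image.1 hB
    rw [Finset.mem_compl] at hk₀
    -- A point `(i₀, j₀)` of the rectangle is needed to read off that each row of `R` and each
    -- column of `C` is free separately.
    rcases (outsideSupport I J k₀).eq_empty_or_nonempty with he | ⟨⟨i₀, j₀⟩, hne⟩
    · rw [he, Finset.sum_empty, Finset.sum_empty]
    obtain ⟨R, C, hRC⟩ := hrect k₀ hk₀
    have h₀ := hne
    rw [hRC, Finset.mem_product] at h₀
    -- `Q` may merge several equivalence classes that agree only outside `S`.
    let Q : Finset (Fin r) := {k | k ∉ T ∧ outsideSupport I J k = outsideSupport I J k₀}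
    have hQ : ∀ {k}, k ∈ Q ↔ k ∉ T ∧ outsideSupport I J k = outsideSupport I J k₀ := by
      intro k
      simp [Q]
    have hin : ∀ k ∈ Q, ∀ i ∈ R, ∀ j ∈ C, ((i, k) ∈ I ∧ (j, k) ∈ J) := by
      intro k hk i hi j hj
      have : (i, j) ∈ outsideSupport I J k := by
        rw [(hQ.1 hk).2, hRC]
        exact Finset.mem_product.2 ⟨hi, hj⟩
      exact (hmem.1 this).1
    rw [hRC]
    refine hcor.sum_product_le (Q := Q) hp hmin ?_ (fun k hk i hi => (hin k hk i hi j₀ h₀.2).1)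
      (fun k hk j hj => (hin k hk i₀ h₀.1 j hj).2) ?_ ?_ hp'
    · exact Finset.disjoint_left.2 fun k hk => (hQ.1 hk).1
    · intro k hk i hi j hj hI hJ
      have hij : (i, j) ∈ outsideSupport I J k₀ := by
        rw [hRC]
        exact Finset.mem_product.2 ⟨hi, hj⟩
      have hijS : (i, j) ∉ S := (hmem.1 hij).2
      have hkT : k ∉ T := fun h => hijS (hTS k h _ (mem_rankOneSupport.2 ⟨hI, hJ⟩))
      rcases hdisj k k₀ hkT hk₀ with h | h
      · exact hk (hQ.2 ⟨hkT, h⟩)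
      · exact Finset.disjoint_left.1 h (hmem.2 ⟨⟨hI, hJ⟩, hijS⟩) hij
    · intro k hk i j hI hJ hij
      rw [← hRC, ← (hQ.1 hk).2]
      exact hmem.2 ⟨⟨hI, hJ⟩, hij⟩
  have hFdisj : (F : Set (Finset (Fin m × Fin n))).PairwiseDisjoint id := by
    intro B hB B' hB' hne
    obtain ⟨k, hk, rfl⟩ := Finset.mem_image.1 (Finset.mem_coe.1 hB)
    obtain ⟨l, hl, rfl⟩ := Finset.mem_image.1 (Finset.mem_coe.1 hB')
    exact (hdisj k l (Finset.mem_compl.1 hk) (Finset.mem_compl.1 hl)).resolve_left hne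
  have hU : ∑ x ∈ F.biUnion id, (A x.1 x.2 - pairProd p x.1 x.2) ^ 2 ≤
      ∑ x ∈ F.biUnion id, (A x.1 x.2 - pairProd p' x.1 x.2) ^ 2 := by
    rw [Finset.sum_biUnion hFdisj, Finset.sum_biUnion hFdisj]
    exact Finset.sum_le_sum hblock
  have hrest : ∀ x ∈ (F.biUnion id)ᶜ, (A x.1 x.2 - pairProd p x.1 x.2) ^ 2 ≤
      (A x.1 x.2 - pairProd p' x.1 x.2) ^ 2 := by
    intro x hx
    -- Outside all rectangles, either the residual of `p` vanishes, or every feasible product does.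
    by_cases hxS : x ∈ S
    · rw [hcor.residual_eq_zero hp hmin hxS]
      simpa using sq_nonneg _
    · have hzero : ∀ q ∈ feasible I J, pairProd q x.1 x.2 = 0 := by
        intro q hq
        rw [pairProd_apply]
        refine Finset.sum_eq_zero fun k _ => ?_
        by_contra h
        have hI := hq.1 x.1 k (left_ne_zero_of_mul h)
        have hJ := hq.2 x.2 k (right_ne_zero_of_mul h)
        have hkT : k ∉ T := fun h => hxS (hTS k h _ (mem_rankOneSupport.2 ⟨hI, hJ⟩))
        exact Finset.mem_compl.1 hx (Finset.mem_biUnion.2 ⟨_, Finset.mem_image.2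
          ⟨k, Finset.mem_compl.2 hkT, rfl⟩, hmem.2 ⟨⟨hI, hJ⟩, hxS⟩⟩)
      rw [hzero p hp, hzero p' hp']
  change loss A p ≤ loss A p'
  rw [loss_eq_sum_add_sum_compl A (F.biUnion id), loss_eq_sum_add_sum_compl A (F.biUnion id) p']
  exact add_le_add hU (Finset.sum_le_sum hrest)

end Blocks

/-! ### Paths to full rank inside a fiber of the product. -/

section Paths

theorem exists_linearMap_surjective_of_finrank_le {V W : Type*} [AddCommGroup V] [Module ℝ V]
    [FiniteDimensional ℝ V] [AddCommGroup W] [Module ℝ W] [FiniteDimensional ℝ W]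
    (h : Module.finrank ℝ W ≤ Module.finrank ℝ V) :
    ∃ g : V →ₗ[ℝ] W, Function.Surjective g := by
  let bV := Module.finBasis ℝ V
  let bW := Module.finBasis ℝ W
  -- Surplus basis vectors of `V` are sent to `0`.
  refine ⟨bV.constr ℝ fun i => if hi : (i : ℕ) < Module.finrank ℝ W then bW ⟨i, hi⟩ else 0,
    LinearMap.range_eq_top.1 (eq_top_iff.2 ?_)⟩
  rw [← bW.span_eq, Submodule.span_le]
  rintro _ ⟨j, rfl⟩
  refine ⟨bV ⟨j, j.2.trans_le h⟩, ?_⟩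
  rw [Module.Basis.constr_basis]
  simp

/-- A matrix with at least as many columns as rows can be completed to a matrix of full row rank
by adding a matrix that vanishes on a complement of its kernel. -/
theorem exists_surjective_add {α κ : Type*} [Fintype α] [Fintype κ] (X : Matrix α κ ℝ)
    (hcard : Fintype.card α ≤ Fintype.card κ) :
    ∃ (E : Matrix κ κ ℝ) (N : Matrix α κ ℝ), X * E = X ∧ N * E = 0 ∧
      Function.Surjective (X + N).mulVec := by
  classical
  obtain ⟨V, hV⟩ := Submodule.exists_isCompl (LinearMap.ker X.mulVecLin)
  obtain ⟨W, hW⟩ := Submodule.exists_isCompl (LinearMap.range X.mulVecLin)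
  have h1 := Submodule.finrank_add_eq_of_isCompl hW
  have h2 := LinearMap.finrank_range_add_finrank_ker X.mulVecLin
  rw [Module.finrank_fintype_fun_eq_card] at h1 h2
  -- The rank is common to both dimension counts, so `hcard` says that the cokernel is no larger
  -- than the kernel.
  obtain ⟨g, hg⟩ := exists_linearMap_surjective_of_finrank_le
    (V := LinearMap.ker X.mulVecLin) (W := W) (by omega)
  -- `E` is the projection onto `V` along the kernel, so `X E = X`; `N` maps the kernel onto `W` and
  -- kills `V`, so `N E = 0`.
  set π := Submodule.projectionOnto _ _ hV
  set f₁ : (κ → ℝ) →ₗ[ℝ] (κ → ℝ) :=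
    LinearMap.id - (LinearMap.ker X.mulVecLin).subtype ∘ₗ π with hf₁
  set f₂ : (κ → ℝ) →ₗ[ℝ] (α → ℝ) := W.subtype ∘ₗ g ∘ₗ π with hf₂
  have hπ1 : ∀ z : LinearMap.ker X.mulVecLin, π z = z := fun z =>
    Submodule.projectionOnto_apply_left hV z
  have hπf : ∀ x, π (f₁ x) = 0 := by
    intro x
    simp [hf₁, hπ1]
  have hXf : ∀ x, X *ᵥ (f₁ x) = X *ᵥ x := by
    intro x
    have : X *ᵥ (π x : κ → ℝ) = 0 := (π x).2
    simp [hf₁, mulVec_sub, this]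
  refine ⟨LinearMap.toMatrix' f₁, LinearMap.toMatrix' f₂, ?_, ?_, ?_⟩
  · apply Matrix.toLin'.injective
    refine LinearMap.ext fun x => ?_
    simp [hXf]
  · apply Matrix.toLin'.injective
    refine LinearMap.ext fun x => ?_
    simp [hf₂, hπf]
  · intro y
    obtain ⟨y₁, ⟨x, rfl⟩, y₂, hy₂, rfl⟩ := Submodule.mem_sup.1
      (hW.sup_eq_top ▸ Submodule.mem_top (x := y))
    obtain ⟨z, hz⟩ := hg ⟨y₂, hy₂⟩
    refine ⟨f₁ x + z, ?_⟩
    have hz0 : X *ᵥ (z : κ → ℝ) = 0 := z.2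
    have h3 : LinearMap.toMatrix' f₂ *ᵥ (f₁ x + z) = y₂ := by
      rw [LinearMap.toMatrix'_mulVec]
      simp [hf₂, hπf, hπ1, hz]
    change (X + LinearMap.toMatrix' f₂) *ᵥ (f₁ x + z) = _
    rw [add_mulVec, h3, mulVec_add, hXf, hz0, add_zero]
    rfl

variable {m n r : ℕ} {I : Finset (Fin m × Fin r)} {J : Finset (Fin n × Fin r)}

/-- The extension by zero of a matrix indexed by subsets. -/
def extendZero (R : Finset (Fin m)) (P : Finset (Fin r)) (M : Matrix R P ℝ) :
    Matrix (Fin m) (Fin r) ℝ :=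
  Matrix.of fun i k => if h : i ∈ R ∧ k ∈ P then M ⟨i, h.1⟩ ⟨k, h.2⟩ else 0

theorem extendZero_of_mem {R : Finset (Fin m)} {P : Finset (Fin r)} (M : Matrix R P ℝ) (i : R)
    (k : P) : extendZero R P M i k = M i k := by
  simp [extendZero]

theorem extendZero_of_not_mem {R : Finset (Fin m)} {P : Finset (Fin r)} (M : Matrix R P ℝ)
    {i : Fin m} {k : Fin r} (h : ¬ (i ∈ R ∧ k ∈ P)) : extendZero R P M i k = 0 := by
  simp only [extendZero, of_apply, dif_neg h]

theorem extendZero_mul_transpose_eq_zero {R : Finset (Fin m)} {C : Finset (Fin n)}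
    {P : Finset (Fin r)} {M : Matrix R P ℝ} {Z : Matrix (Fin n) (Fin r) ℝ}
    (hZ : ∀ j ∉ C, ∀ k ∈ P, Z j k = 0)
    (h : M * (Z.submatrix (fun j : C => (j : Fin n)) (fun k : P => (k : Fin r)))ᵀ = 0) :
    extendZero R P M * Zᵀ = 0 := by
  ext i j
  rw [Matrix.mul_apply, ← Finset.sum_subset (Finset.subset_univ P), ← Finset.sum_coe_sort P]
  · by_cases hi : i ∈ R
    · by_cases hj : j ∈ C
      · have h' := congrFun (congrFun h ⟨i, hi⟩) ⟨j, hj⟩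
        rw [Matrix.mul_apply] at h'
        refine Eq.trans (Finset.sum_congr rfl fun k _ => ?_) h'
        rw [← extendZero_of_mem M ⟨i, hi⟩ k]
        rfl
      · exact Finset.sum_eq_zero fun k _ => by rw [transpose_apply, hZ j hj k k.2, mul_zero]
    · exact Finset.sum_eq_zero fun k _ => by
        rw [extendZero_of_not_mem M fun h => hi h.1, zero_mul]
  · intro k _ hk
    rw [extendZero_of_not_mem M fun h => hk h.2, zero_mul]

/-- The feasible pairs with a given product. -/
def feasibleFiber (I : Finset (Fin m × Fin r)) (J : Finset (Fin n × Fin r))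
    (M : Matrix (Fin m) (Fin n) ℝ) : Set (Matrix (Fin m) (Fin r) ℝ × Matrix (Fin n) (Fin r) ℝ) :=
  {q | q ∈ feasible I J ∧ pairProd q = M}

theorem smul_mem_feasible {p : Matrix (Fin m) (Fin r) ℝ × Matrix (Fin n) (Fin r) ℝ}
    (hp : p ∈ feasible I J) (t : ℝ) : t • p ∈ feasible I J :=
  ⟨fun i k h => hp.1 i k (right_ne_zero_of_mul h), fun j k h => hp.2 j k (right_ne_zero_of_mul h)⟩

theorem joinedIn_feasibleFiber_add {p d : Matrix (Fin m) (Fin r) ℝ × Matrix (Fin n) (Fin r) ℝ}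
    {M : Matrix (Fin m) (Fin n) ℝ} (hp : p ∈ feasible I J) (hd : d ∈ feasible I J)
    (h : ∀ t : ℝ, pairProd (p + t • d) = M) : JoinedIn (feasibleFiber I J M) p (p + d) := by
  refine JoinedIn.ofLine (f := fun t : ℝ => p + t • d) (by fun_prop) (by simp) (by simp) ?_
  rintro _ ⟨t, -, rfl⟩
  exact ⟨add_mem_feasible hp (smul_mem_feasible hd t), h t⟩

theorem subFullRowRank_of_surjective {d : ℕ} {M : Matrix (Fin d) (Fin r) ℝ} {R : Finset (Fin d)}
    {P : Finset (Fin r)} (h : Function.Surjective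
      (M.submatrix (fun i : R => (i : Fin d)) (fun k : P => (k : Fin r))).mulVec) :
    SubFullRowRank M R P := by
  have : LinearMap.range (M.submatrix (fun i : R => (i : Fin d))
      (fun k : P => (k : Fin r))).mulVecLin = ⊤ := LinearMap.range_eq_top.2 h
  rw [SubFullRowRank, Matrix.rank, this, finrank_top, Module.finrank_fintype_fun_eq_card,
    Fintype.card_coe]

/-- A block with enough columns can be moved to full row rank of the left factor without changing
the product. -/
theorem IsBlock.exists_joinedIn_left {P : Finset (Fin r)} {R : Finset (Fin m)}
    {C : Finset (Fin n)} (hB : IsBlock I J P R C) (hcard : R.card ≤ P.card)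
    {p : Matrix (Fin m) (Fin r) ℝ × Matrix (Fin n) (Fin r) ℝ} (hp : p ∈ feasible I J) :
    ∃ p', JoinedIn (feasibleFiber I J (pairProd p)) p p' ∧ ColumnsIn P (p' - p) ∧
      SubFullRowRank p'.1 R P := by
  rcases hB.full with ⟨rfl, rfl⟩ | ⟨hR, hC⟩
  · refine ⟨p, JoinedIn.refl ⟨hp, rfl⟩, ?_, ?_⟩
    · simp [ColumnsIn]
    · exact subFullRowRank_of_surjective fun y => ⟨0, Subsingleton.elim _ _⟩
  set X₀ := p.1.submatrix (fun i : R => (i : Fin m)) (fun k : P => (k : Fin r)) with hX₀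
  set Y₀ := p.2.submatrix (fun j : C => (j : Fin n)) (fun k : P => (k : Fin r)) with hY₀
  obtain ⟨E, N, hXE, hNE, hsurj⟩ := exists_surjective_add X₀ (by simpa using hcard)
  -- The path has two segments: `Y₀` moves to `Y₀ Eᵀ`, harmless because `X₀ E = X₀`; then `N` is
  -- added to `X₀`, harmless because `N (Y₀ Eᵀ)ᵀ = N E Y₀ᵀ = 0`.
  set dX := extendZero R P N with hdX
  set dY := extendZero C P (Y₀ * Eᵀ - Y₀) with hdY
  have hpX : ∀ i ∉ R, ∀ k ∈ P, p.1 i k = 0 := fun i hi k hk =>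
    by_contra fun h => hi (hR k hk i (hp.1 i k h))
  have hpY : ∀ j ∉ C, ∀ k ∈ P, p.2 j k = 0 := fun j hj k hk =>
    by_contra fun h => hj (hC k hk j (hp.2 j k h))
  have h1 : p.1 * dYᵀ = 0 := by
    rw [← transpose_inj, transpose_mul, transpose_transpose, transpose_zero]
    refine extendZero_mul_transpose_eq_zero hpX ?_
    rw [← transpose_inj, transpose_mul, transpose_transpose, transpose_zero, ← hX₀,
      transpose_sub, transpose_mul, transpose_transpose, Matrix.mul_sub, ← Matrix.mul_assoc, hXE,
      sub_self]
  have h2 : dX * (p.2 + dY)ᵀ = 0 := by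
    refine extendZero_mul_transpose_eq_zero (C := C) ?_ ?_
    · intro j hj k hk
      rw [Matrix.add_apply, hpY j hj k hk, hdY, extendZero_of_not_mem _ fun h => hj h.1, add_zero]
    · have : (p.2 + dY).submatrix (fun j : C => (j : Fin n)) (fun k : P => (k : Fin r))
          = Y₀ * Eᵀ := by
        ext j k
        rw [submatrix_apply, Matrix.add_apply, hdY, extendZero_of_mem, Matrix.sub_apply, hY₀,
          submatrix_apply]
        ring
      rw [this, transpose_mul, transpose_transpose, ← Matrix.mul_assoc, hNE, Matrix.zero_mul]
  have hf1 : ((0, dY) : Matrix (Fin m) (Fin r) ℝ × Matrix (Fin n) (Fin r) ℝ) ∈ feasible I J := by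
    refine ⟨fun i k h => absurd rfl h, fun j k h => ?_⟩
    by_contra h'
    exact h (extendZero_of_not_mem _ fun hjk => h' (hB.cols k hjk.2 j hjk.1))
  have hf2 : ((dX, 0) : Matrix (Fin m) (Fin r) ℝ × Matrix (Fin n) (Fin r) ℝ) ∈ feasible I J := by
    refine ⟨fun i k h => ?_, fun j k h => absurd rfl h⟩
    by_contra h'
    exact h (extendZero_of_not_mem _ fun hjk => h' (hB.rows k hjk.2 i hjk.1))
  have hp1 : p + (0, dY) ∈ feasible I J := add_mem_feasible hp hf1
  refine ⟨p + (0, dY) + (dX, 0), (joinedIn_feasibleFiber_add hp hf1 fun t => ?_).trans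
    (joinedIn_feasibleFiber_add hp1 hf2 fun t => ?_), ⟨fun i k hk => ?_, fun j k hk => ?_⟩,
    subFullRowRank_of_surjective ?_⟩
  · simp [pairProd, Matrix.mul_add, h1]
  · have h3 : pairProd (p + (0, dY)) = pairProd p := by simp [pairProd, Matrix.mul_add, h1]
    rw [← h3]
    have h2' : dX * (p.2ᵀ + dYᵀ) = 0 := by rw [← transpose_add, h2]
    simp [pairProd, Matrix.add_mul, h2']
  · have : dX i k = 0 := extendZero_of_not_mem _ fun h => hk h.2
    simp [this]
  · have : dY j k = 0 := extendZero_of_not_mem _ fun h => hk h.2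
    simp [this]
  · convert hsurj using 2
    ext i k
    have : dX i k = N i k := extendZero_of_mem N i k
    simp [hX₀, this]

theorem IsBlock.exists_joinedIn {P : Finset (Fin r)} {R : Finset (Fin m)} {C : Finset (Fin n)}
    (hB : IsBlock I J P R C) (hcard : min C.card R.card ≤ P.card)
    {p : Matrix (Fin m) (Fin r) ℝ × Matrix (Fin n) (Fin r) ℝ} (hp : p ∈ feasible I J) :
    ∃ p', JoinedIn (feasibleFiber I J (pairProd p)) p p' ∧ ColumnsIn P (p' - p) ∧
      (SubFullRowRank p'.1 R P ∨ SubFullRowRank p'.2 C P) := by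
  rcases min_le_iff.1 hcard with h | h
  · obtain ⟨p', hj, hc, hr⟩ := hB.swap.exists_joinedIn_left h (swap_mem_feasible hp)
    refine ⟨p'.swap, ?_, ⟨hc.2, hc.1⟩, Or.inr hr⟩
    refine JoinedIn.mono (hj.map continuous_swap) ?_
    rintro _ ⟨q, ⟨hq, hqp⟩, rfl⟩
    refine ⟨swap_mem_feasible hq, ?_⟩
    rw [pairProd_swap, hqp, pairProd_swap, transpose_transpose]
  · obtain ⟨p', hj, hc, hr⟩ := hB.exists_joinedIn_left h hp
    exact ⟨p', hj, hc, Or.inl hr⟩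

theorem SubFullRowRank.congr {d : ℕ} {M M' : Matrix (Fin d) (Fin r) ℝ} {R : Finset (Fin d)}
    {P : Finset (Fin r)} (h : SubFullRowRank M R P) (hM : ∀ i, ∀ k ∈ P, M' i k = M i k) :
    SubFullRowRank M' R P := by
  have : M'.submatrix (fun i : R => (i : Fin d)) (fun k : P => (k : Fin r))
      = M.submatrix (fun i : R => (i : Fin d)) (fun k : P => (k : Fin r)) := by
    ext i k
    exact hM i k k.2
  rwa [SubFullRowRank, this]

/-- Every feasible pair is joined to a CEC-full-rank pair inside its fiber of the product map. -/
theorem exists_joinedIn_cecFullRank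
    {p : Matrix (Fin m) (Fin r) ℝ × Matrix (Fin n) (Fin r) ℝ} (hp : p ∈ feasible I J) :
    ∃ p', JoinedIn (feasibleFiber I J (pairProd p)) p p' ∧ CECFullRank I J p' := by
  suffices h : ∀ 𝓒 ⊆ completeClasses I J, ∃ p', JoinedIn (feasibleFiber I J (pairProd p)) p p' ∧
      ∀ P ∈ 𝓒, SubFullRowRank p'.1 (classRows I J P) P ∨
        SubFullRowRank p'.2 (classCols I J P) P from h _ subset_rfl
  intro 𝓒
  induction 𝓒 using Finset.induction_on with
  | empty => exact fun _ => ⟨p, JoinedIn.refl ⟨hp, rfl⟩, by simp⟩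
  | insert P 𝓒 hP ih =>
    intro hsub
    obtain ⟨p', hj, hr⟩ := ih ((Finset.subset_insert _ _).trans hsub)
    have hPc := Finset.mem_filter.1 (hsub (Finset.mem_insert_self P 𝓒))
    obtain ⟨p'', hj', hc, hr'⟩ := (isBlock_of_mem_classes hPc.1).exists_joinedIn hPc.2
      hj.target_mem.1
    rw [hj.target_mem.2] at hj'
    refine ⟨p'', hj.trans hj', fun P' hP' => ?_⟩
    rcases Finset.mem_insert.1 hP' with rfl | hmem
    · exact hr'
    -- Treating `P` moves only its own columns, so classes treated earlier keep their full rank.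
    · have hd := disjoint_of_mem_classes (Finset.mem_filter.1 (hsub hP')).1 hPc.1
        fun e => hP (e ▸ hmem)
      exact (hr P' hmem).imp
        (fun h => h.congr fun i k hk => sub_eq_zero.1 (hc.1 i k (Finset.disjoint_left.1 hd hk)))
        (fun h => h.congr fun i k hk => sub_eq_zero.1 (hc.2 i k (Finset.disjoint_left.1 hd hk)))

end Paths

end FixedSupport

theorem mainTheorem6 (m n r : ℕ)
    (I : Finset (Fin m × Fin r)) (J : Finset (Fin n × Fin r))
    (hrect : ∀ k, k ∉ FixedSupport.completeIndices I J →
      FixedSupport.IsRectangular (FixedSupport.outsideSupport I J k))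
    (hdisj : ∀ k l, k ∉ FixedSupport.completeIndices I J →
      l ∉ FixedSupport.completeIndices I J →
        FixedSupport.outsideSupport I J k = FixedSupport.outsideSupport I J l ∨
          Disjoint (FixedSupport.outsideSupport I J k) (FixedSupport.outsideSupport I J l))
    (A : Matrix (Fin m) (Fin n) ℝ)
    (X : Matrix (Fin m) (Fin r) ℝ) (Y : Matrix (Fin n) (Fin r) ℝ)
    (hXY : (X, Y) ∈ FixedSupport.feasible I J) :
    (FixedSupport.CECFullRank I J (X, Y) →
      ¬ FixedSupport.IsSpuriousLocalMin A I J (X, Y)) ∧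
    (¬ FixedSupport.CECFullRank I J (X, Y) →
      ∃ (X' : Matrix (Fin m) (Fin r) ℝ) (Y' : Matrix (Fin n) (Fin r) ℝ)
        (γ : Path (X, Y) (X', Y')),
        (∀ t, γ t ∈ FixedSupport.feasible I J) ∧
        (∀ t, FixedSupport.loss A (γ t) = FixedSupport.loss A (X, Y)) ∧
        ¬ FixedSupport.IsSpuriousLocalMin A I J (X', Y')) := by
  have key : ∀ p ∈ FixedSupport.feasible I J, FixedSupport.CECFullRank I J p →
      ¬ FixedSupport.IsSpuriousLocalMin A I J p := fun p hp hfull hsp =>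
    hsp.2.2 (hfull.isMinOn hrect hdisj hp hsp.2.1)
  refine ⟨key _ hXY, fun _ => ?_⟩
  obtain ⟨p', hj, hfull⟩ := FixedSupport.exists_joinedIn_cecFullRank hXY
  refine ⟨p'.1, p'.2, hj.somePath, fun t => (hj.somePath_mem t).1, fun t => ?_,
    key _ hj.target_mem.1 hfull⟩
  -- The loss depends on the pair only through its product, which is constant along the path.
  rw [FixedSupport.loss_eq_sum, FixedSupport.loss_eq_sum, (hj.somePath_mem t).2]
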